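/- For $\beta=1,2,4$ let $\mathbb H_{2,\beta}$ be the real vector space of $2\times2$ real symmetric, complex Hermitian, respectively quaternion-Hermitian matrices, with the inner product $\langle x|y\rangle=\Re\,\mathrm{tr}(xy)$; for $\theta\in\mathbb H_{2,\beta}$ put $\det\theta=\theta_{11}\theta_{22}-|\theta_{12}|^2$. Let $p>\beta/2$ and $c>1$. The gamma ensemble with parameters $p,c$ is the probability law $\mu$ on $\mathbb H_{2,\beta}$ such that, for $\mathbf X\sim\mu$, $$\mathbb E\,e^{\langle\theta|\mathbf X\rangle}=\left(1-2c\sqrt{1+\beta}\,\mathrm{tr}\,\theta+\beta(\mathrm{tr}\,\theta)^2+4\det\theta\right)^{-p}$$ for all $\theta$ in the connected component of $0$ of the set $\{\theta\in\mathbb H_{2,\beta}:1-2c\sqrt{1+\beta}\,\mathrm{tr}\,\theta+\beta(\mathrm{tr}\,\theta)^2+4\det\theta>0\}$ (explicitly, the part of that set where $\sqrt{1+\beta}\,\mathrm{tr}\,\theta<c$). Then $\mu$ is a Meixner ensemble with parameters $$A=\frac1{1+2p},\qquad B=0,\qquad C=0,$$ that is: $\mu$ is invariant under $\mathbf X\mapsto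 U\mathbf XU^*$ for all orthogonal, unitary, respectively symplectic $2\times 2$ matrices $U$; it has finite second moments; and if $\mathbf X,\mathbf Y$ are independent with law $\mu$ and $\mathbf S=\mathbf X+\mathbf Y$, then $$\mathbb E\big((\mathbf X-\mathbf Y)^2\,\big|\,\mathbf S\big)=A\mathbf S^2+B\mathbf S+C\mathbf I_2 .$$ The mean and the variance are $$\mathbb E(\mathbf X)=2pc\sqrt{1+\beta}\;\mathbf I_2,\qquad \mathrm{Var}(\mathbf X):=\mathbb E(\mathbf X^2)-(\mathbb E\mathbf X)^2=4pc^2(1+\beta)\,\mathbf I_2 .$$ For the standardization $\widetilde{\mathbf X}=(\mathbf X-m\mathbf I_2)/\sigma$ with $m=2pc\sqrt{1+\beta}$ and $\sigma=\sqrt{4pc^2(1+\beta)}$, which satisfies $\mathbb E\widetilde{\mathbf X}=0$ and $\mathbb E\widetilde{\mathbf X}^2=\mathbf I_2$, and for an independent copy $\widetilde{\mathbf Y}$ of it and $\widetilde{\mathbf S}=\widetilde{\mathbf X}+\widetilde{\mathbf Y}$, $$\mathbb E\big((\widetilde{\mathbf X}-\widetilde{\mathbf Y})^2\,\big|\,\widetilde{\mathbf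 S}\big)=\frac{2}{1+2a}\left(\mathbf I_2+b\,\widetilde{\mathbf S}+a\,\widetilde{\mathbf S}^2\right)\qquad\text{with } a=\frac1{4p},\quad b=\frac1{\sqrt p}.$$ -/

import Mathlib

open MeasureTheory ProbabilityTheory
open scoped ENNReal Quaternion

noncomputable section

namespace MatrixEnsemble

/-- The real vector space of self-adjoint `n × n` matrices with entries in `K`, where
`star` on matrices is the conjugate transpose. For `K = ℝ`, `ℂ`, `ℍ` these are the spaces
of real symmetric, complex Hermitian and quaternion-Hermitian matrices
(Peirce constant `β = 1, 2, 4`). -/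
abbrev Herm (n : ℕ) (K : Type) [NormedRing K] [StarRing K] : Type :=
  selfAdjoint (Matrix (Fin n) (Fin n) K)

/-- The Borel σ-algebra on the space of self-adjoint matrices. -/
instance instMeasurableSpaceHerm (n : ℕ) (K : Type) [NormedRing K] [StarRing K] :
    MeasurableSpace (Herm n K) := borel _

instance instBorelSpaceHerm (n : ℕ) (K : Type) [NormedRing K] [StarRing K] :
    BorelSpace (Herm n K) := ⟨rfl⟩

instance instStarModuleRealQuaternion : StarModule ℝ ℍ[ℝ] :=
  ⟨fun r x => by ext <;> simp⟩

variable {n : ℕ} {K : Type} [NormedRing K] [StarRing K] [InnerProductSpace ℝ K]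
  [StarModule ℝ K]

/-- The real part of a scalar: the inner product of `1` and `x`. -/
def re (x : K) : ℝ := inner ℝ (1 : K) x

theorem re_real (x : ℝ) : re x = x := by simp [re]

theorem re_complex (x : ℂ) : re x = x.re := by simp [re, Complex.inner]

theorem re_quaternion (x : ℍ[ℝ]) : re x = QuaternionAlgebra.re x := by
  simp [re, Quaternion.inner_def]

/-- The (real) trace of a self-adjoint matrix. -/
def tr (θ : Herm n K) : ℝ := re (Matrix.trace (θ : Matrix (Fin n) (Fin n) K))

/-- The (real) determinant `θ₁₁ θ₂₂ - θ₁₂ θ₂₁ = θ₁₁ θ₂₂ - |θ₁₂|²` of a self-adjoint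
`2 × 2` matrix. -/
def det (θ : Herm 2 K) : ℝ :=
  re ((θ : Matrix (Fin 2) (Fin 2) K) 0 0 * (θ : Matrix (Fin 2) (Fin 2) K) 1 1
    - (θ : Matrix (Fin 2) (Fin 2) K) 0 1 * (θ : Matrix (Fin 2) (Fin 2) K) 1 0)

/-- The Euclidean inner product `⟨x|y⟩ = Re tr (x y)`. -/
def pairing (x y : Herm n K) : ℝ :=
  re (Matrix.trace ((x : Matrix (Fin n) (Fin n) K) * (y : Matrix (Fin n) (Fin n) K)))

/-- The Laplace transform `L(θ) = E exp ⟨θ|X⟩ ∈ [0, ∞]` of a law on self-adjoint matrices. -/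
def laplace (μ : Measure (Herm n K)) (θ : Herm n K) : ℝ≥0∞ :=
  ∫⁻ X, ENNReal.ofReal (Real.exp (pairing θ X)) ∂μ

/-- The matrix `U X U*`. -/
def rotate (U : Matrix (Fin n) (Fin n) K) (X : Herm n K) : Herm n K :=
  ⟨U * (X : Matrix (Fin n) (Fin n) K) * star U, X.2.conjugate U⟩

/-- Invariance under `X ↦ U X U*` for every `U` with `U U* = U* U = 1`, i.e. for `U` in the
orthogonal, unitary or (compact) symplectic group when `K = ℝ`, `ℂ` or `ℍ`. -/
def RotationInvariant (μ : Measure (Herm n K)) : Prop :=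
  ∀ U ∈ unitary (Matrix (Fin n) (Fin n) K), μ.map (rotate U) = μ

/-- Finite second moments: all entries are square-integrable. -/
def HasSecondMoments (μ : Measure (Herm n K)) : Prop :=
  ∀ i j, MemLp (fun X : Herm n K => (X : Matrix (Fin n) (Fin n) K) i j) 2 μ

/-- The property `E((X - Y)² | X + Y) = f (X + Y)` almost surely, for `X`, `Y` independent
with the same law `μ` (the two coordinates under `μ ⊗ μ`). The conditional expectation of a
random matrix, given the σ-algebra generated by `X + Y`, is taken entry by entry. -/
def CondSqDiffEq [CompleteSpace K] (μ : Measure (Herm n K))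
    (f : Matrix (Fin n) (Fin n) K → Matrix (Fin n) (Fin n) K) : Prop :=
  ∀ i j,
    (μ.prod μ)[fun ω : Herm n K × Herm n K =>
        (((ω.1 - ω.2 : Herm n K) : Matrix (Fin n) (Fin n) K) ^ 2) i j |
      MeasurableSpace.comap (fun ω : Herm n K × Herm n K => ω.1 + ω.2) inferInstance]
    =ᵐ[μ.prod μ]
    fun ω => f ((ω.1 + ω.2 : Herm n K) : Matrix (Fin n) (Fin n) K) i j

/-- Meixner ensembles with parameters `A, B, C`. -/
structure IsMeixnerEnsemble [CompleteSpace K] (μ : Measure (Herm n K)) (A B C : ℝ) :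
    Prop where
  isProbabilityMeasure : IsProbabilityMeasure μ
  rotationInvariant : RotationInvariant μ
  hasSecondMoments : HasSecondMoments μ
  condSqDiffEq : CondSqDiffEq μ (fun S => A • S ^ 2 + B • S + C • 1)

/-- `E(X)`, entry by entry. -/
def mean (μ : Measure (Herm n K)) : Matrix (Fin n) (Fin n) K :=
  Matrix.of fun i j => ∫ X : Herm n K, (X : Matrix (Fin n) (Fin n) K) i j ∂μ

/-- `E(X²)`, entry by entry. -/
def secondMoment (μ : Measure (Herm n K)) : Matrix (Fin n) (Fin n) K :=
  Matrix.of fun i j => ∫ X : Herm n K, ((X : Matrix (Fin n) (Fin n) K) ^ 2) i j ∂μ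

/-- `Var(X) = E(X²) - (E X)²`. -/
def variance (μ : Measure (Herm n K)) : Matrix (Fin n) (Fin n) K :=
  secondMoment μ - mean μ ^ 2

/-- The law of `σ⁻¹ (X - m I)` for `X` with law `μ`. -/
def standardize (m σ : ℝ) (μ : Measure (Herm n K)) : Measure (Herm n K) :=
  μ.map fun X => σ⁻¹ • (X - m • (1 : Herm n K))

/-- The law `ν` is standardized (`E X = 0`, `E X² = I`), and independent `X`, `Y` with law `ν`
and `S = X + Y` satisfy `E((X - Y)² | S) = 2 / (1 + 2a) · (I + b S + a S²)`. -/
structure IsStandardMeixner [CompleteSpace K] (ν : Measure (Herm n K)) (a b : ℝ) :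
    Prop where
  hasSecondMoments : HasSecondMoments ν
  mean_eq : mean ν = 0
  secondMoment_eq : secondMoment ν = 1
  condSqDiffEq : CondSqDiffEq ν (fun S => (2 / (1 + 2 * a)) • (1 + b • S + a • S ^ 2))

/-- `1 - 2c√(1+β) tr θ + β tr² θ + 4 det θ`. -/
def gammaPoly (β c : ℝ) (θ : Herm 2 K) : ℝ :=
  1 - 2 * c * √(1 + β) * tr θ + β * tr θ ^ 2 + 4 * det θ

/-- The connected component of `0` in `{θ | gammaPoly β c θ > 0}`. With `u = √(1+β) tr θ`
one has `gammaPoly β c θ = (c - u)² - (c² - 1) - (tr² θ - 4 det θ)` and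
`tr² θ - 4 det θ ≥ 0`, so for `c > 1` that set has two components, `u < c` and `u > c`. -/
def gammaDomain (β c : ℝ) : Set (Herm 2 K) :=
  {θ | √(1 + β) * tr θ < c ∧ 0 < gammaPoly β c θ}

/-- `μ` is the gamma ensemble with parameters `p, c`: the probability law with Laplace
transform `gammaPoly β c θ ^ (-p)` on `gammaDomain β c`. -/
structure IsGammaEnsemble (β p c : ℝ) (μ : Measure (Herm 2 K)) : Prop where
  isProbabilityMeasure : IsProbabilityMeasure μ
  laplace_eq : ∀ θ ∈ gammaDomain (K := K) β c,
    laplace μ θ = ENNReal.ofReal (gammaPoly β c θ ^ (-p))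

end MatrixEnsemble

end

noncomputable section

namespace MatrixEnsemble

/-! The Laplace transform is the power `-p` of a quadratic polynomial `P`. Along a line `θ + sη` it
equals `(P + sD + s²Q)^(-p)`, where `D` is linear in `η` and `Q = gammaQuad β η` does not depend on
`θ`. Two derivatives at `s = 0` give the moments `M₀, M₁, M₂` of `⟨η|X⟩` weighted by `e^⟨θ|X⟩`
(`IsGammaEnsemble.moments`).

By independence, `E[(⟨η|X-Y⟩² - A⟨η|S⟩²) e^⟨θ|S⟩] = 2(1-A)M₀M₂ - 2(1+A)M₁²`. Its `D²` term is
proportional to `1 - A(1+2p)`, so it vanishes for `A = 1/(1+2p)`, and what is left is a multiple of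
`Q(η)` with a factor independent of `η` (`IsGammaEnsemble.integral_pair`).

Each real coordinate of `X²` is a sum `∑ w_l ⟨η_l|X⟩²` with `∑ w_l Q(η_l) = 0`
(`exists_sq_entry_eq_sum`); this is where `β = dim K` matters. Hence the entries of `(X-Y)² - A S²`
integrate to zero against `e^⟨θ|S⟩` for `θ` near `0` on every line. Uniqueness of Laplace
transforms, applied to the images under `S` of the positive and negative parts, turns this into the
conditional expectation identity.

The same cancellation of `Q` gives `E X²`. Invariance holds because `P` depends on `θ` only through
`tr θ` and `⟨θ|θ⟩`. The standardized form is an affine change of variable. -/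

/-- The properties of the scalars `ℝ`, `ℂ`, `ℍ` on which the computations with self-adjoint
`2 × 2` matrices rely. -/
class IsHermScalars (K : Type) [NormedRing K] [StarRing K] [InnerProductSpace ℝ K] : Prop where
  nontrivial : Nontrivial K
  finiteDimensional : FiniteDimensional ℝ K
  isScalarTower : IsScalarTower ℝ K K
  smulCommClass : SMulCommClass ℝ K K
  exists_eq_smul_one : ∀ x : K, star x = x → ∃ r : ℝ, x = r • (1 : K)
  inner_eq : ∀ x y : K, inner ℝ x y = re (x * star y)
  re_mul_comm : ∀ x y : K, re (x * y) = re (y * x)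
  mul_star_self : ∀ x : K, x * star x = (‖x‖ ^ 2) • (1 : K)

attribute [instance] IsHermScalars.nontrivial IsHermScalars.finiteDimensional
  IsHermScalars.isScalarTower IsHermScalars.smulCommClass

instance : IsHermScalars ℝ where
  nontrivial := inferInstance
  finiteDimensional := inferInstance
  isScalarTower := inferInstance
  smulCommClass := inferInstance
  exists_eq_smul_one x _ := ⟨x, by simp⟩
  inner_eq x y := by simp [re, mul_comm]
  re_mul_comm x y := by rw [mul_comm]
  mul_star_self x := by simp [sq]

instance : IsHermScalars ℂ where
  nontrivial := inferInstance
  finiteDimensional := inferInstance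
  isScalarTower := inferInstance
  smulCommClass := inferInstance
  exists_eq_smul_one x hx := ⟨x.re, by
    rw [Complex.real_smul, mul_one]; exact (Complex.conj_eq_iff_re.1 hx).symm⟩
  inner_eq x y := by
    rw [re_complex, Complex.inner]; simp; ring
  re_mul_comm x y := by rw [mul_comm]
  mul_star_self x := by
    rw [Complex.real_smul, mul_one]
    simpa using Complex.mul_conj' x

instance : IsHermScalars ℍ[ℝ] where
  nontrivial := inferInstance
  finiteDimensional := inferInstance
  isScalarTower := inferInstance
  smulCommClass := inferInstance
  exists_eq_smul_one x hx := by
    exact ⟨x.re, by simpa [Quaternion.ext_iff] using Quaternion.star_eq_self.1 hx⟩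
  inner_eq x y := by rw [re_quaternion, Quaternion.inner_def]
  re_mul_comm x y := by
    rw [re_quaternion, re_quaternion, Quaternion.re_mul, Quaternion.re_mul]; ring
  mul_star_self x := by
    rw [Quaternion.self_mul_star, Quaternion.normSq_eq_norm_mul_self, ← sq, ← Quaternion.coe_one,
      ← Quaternion.coe_smul, smul_eq_mul, mul_one]

/-! ### Real part, star and norm on the scalars -/

section Scalars

variable {K : Type} [NormedRing K] [InnerProductSpace ℝ K]

theorem re_add (x y : K) : re (x + y) = re x + re y := inner_add_right _ _ _

theorem re_sub (x y : K) : re (x - y) = re x - re y := inner_sub_right _ _ _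

theorem re_smul (r : ℝ) (x : K) : re (r • x) = r * re x := real_inner_smul_right _ _ _

theorem inner_one_right (x : K) : inner ℝ x 1 = re x := real_inner_comm _ _

variable [StarRing K] [IsHermScalars K]

/-- Taking norms in `1 * star 1 = ‖1‖² • 1` gives `‖1‖ = ‖1‖³`. -/
theorem norm_one_scalar : ‖(1 : K)‖ = 1 := by
  have h := congrArg norm (IsHermScalars.mul_star_self (1 : K))
  have h0 : 0 < ‖(1 : K)‖ := norm_pos_iff.2 one_ne_zero
  simp only [star_one, mul_one, norm_smul, norm_pow, norm_norm] at h
  have : ‖(1 : K)‖ ^ 2 = 1 := by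
    field_simp at h; nlinarith
  nlinarith

theorem re_one : re (1 : K) = 1 := by
  rw [re, real_inner_self_eq_norm_sq, norm_one_scalar]; norm_num

theorem re_star (x : K) : re (star x) = re x := by
  rw [re, re, ← one_mul (star x), ← re, ← IsHermScalars.inner_eq]

theorem norm_star_scalar (x : K) : ‖star x‖ = ‖x‖ := by
  have : ‖star x‖ ^ 2 = ‖x‖ ^ 2 := by
    rw [← real_inner_self_eq_norm_sq, ← real_inner_self_eq_norm_sq, IsHermScalars.inner_eq,
      IsHermScalars.inner_eq, star_star, IsHermScalars.re_mul_comm]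
  exact (pow_left_inj₀ (norm_nonneg _) (norm_nonneg _) two_ne_zero).1 this

theorem star_mul_self_scalar (x : K) : star x * x = (‖x‖ ^ 2) • (1 : K) := by
  simpa [norm_star_scalar] using IsHermScalars.mul_star_self (star x)

theorem inner_star_right (x y : K) : inner ℝ x (star y) = inner ℝ (star x) y := by
  rw [IsHermScalars.inner_eq, IsHermScalars.inner_eq, star_star, ← re_star, star_mul,
    IsHermScalars.re_mul_comm]

theorem re_mul_star (x y : K) : re (x * star y) = inner ℝ x y := (IsHermScalars.inner_eq x y).symm

end Scalars

/-! ### Coordinates on self-adjoint `2 × 2` matrices -/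

section Coordinates

variable {K : Type} [NormedRing K] [StarRing K] [InnerProductSpace ℝ K] [StarModule ℝ K]

/-- The self-adjoint matrix with diagonal entries `a`, `d` and upper right entry `b`. -/
def hermOf (a d : ℝ) (b : K) : Herm 2 K :=
  ⟨!![a • 1, b; star b, d • 1], by
    rw [selfAdjoint.mem_iff]
    ext i j
    fin_cases i <;> fin_cases j <;> simp [Matrix.star_apply]⟩

theorem coe_hermOf (a d : ℝ) (b : K) :
    ((hermOf a d b : Herm 2 K) : Matrix (Fin 2) (Fin 2) K) = !![a • 1, b; star b, d • 1] := rfl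

theorem hermOf_add (a d a' d' : ℝ) (b b' : K) :
    hermOf a d b + hermOf a' d' b' = hermOf (a + a') (d + d') (b + b') := by
  ext i j
  fin_cases i <;> fin_cases j <;> simp [coe_hermOf, add_smul]

theorem smul_hermOf (r a d : ℝ) (b : K) :
    r • hermOf a d b = hermOf (r * a) (r * d) (r • b) := by
  ext i j
  fin_cases i <;> fin_cases j <;> simp [coe_hermOf, mul_smul]

theorem hermOf_one : (1 : Herm 2 K) = hermOf 1 1 0 := by
  ext i j
  fin_cases i <;> fin_cases j <;> simp [coe_hermOf]

variable [IsHermScalars K]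

theorem exists_eq_hermOf (X : Herm 2 K) : ∃ (a d : ℝ) (b : K), X = hermOf a d b := by
  have h : ∀ i j, star ((X : Matrix (Fin 2) (Fin 2) K) i j) =
      (X : Matrix (Fin 2) (Fin 2) K) j i := fun i j => by
    conv_rhs => rw [← selfAdjoint.mem_iff.1 X.2]
    rfl
  obtain ⟨a, ha⟩ := IsHermScalars.exists_eq_smul_one _ (h 0 0)
  obtain ⟨d, hd⟩ := IsHermScalars.exists_eq_smul_one _ (h 1 1)
  refine ⟨a, d, (X : Matrix (Fin 2) (Fin 2) K) 0 1, ?_⟩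
  ext i j
  fin_cases i <;> fin_cases j <;> simp [coe_hermOf, ha, hd, h]

theorem tr_hermOf (a d : ℝ) (b : K) : tr (hermOf a d b) = a + d := by
  simp [tr, coe_hermOf, Matrix.trace_fin_two, re_add, re_smul, re_one]

theorem det_hermOf (a d : ℝ) (b : K) : det (hermOf a d b) = a * d - ‖b‖ ^ 2 := by
  simp [det, coe_hermOf, re_sub, re_smul, re_one, IsHermScalars.mul_star_self, mul_comm]

theorem pairing_hermOf (a d a' d' : ℝ) (b b' : K) :
    pairing (hermOf a d b) (hermOf a' d' b') = a * a' + d * d' + 2 * inner ℝ b b' := by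
  have h : re (star b * b') = inner ℝ b b' := by
    rw [IsHermScalars.re_mul_comm, re_mul_star, real_inner_comm]
  simp [pairing, coe_hermOf, Matrix.trace_fin_two,
    re_add, re_smul, re_one, re_mul_star, h]
  ring

theorem sq_hermOf (a d : ℝ) (b : K) :
    ((hermOf a d b : Herm 2 K) : Matrix (Fin 2) (Fin 2) K) ^ 2 =
      (hermOf (a ^ 2 + ‖b‖ ^ 2) (d ^ 2 + ‖b‖ ^ 2) ((a + d) • b) : Herm 2 K) := by
  rw [sq]
  ext i j
  fin_cases i <;> fin_cases j <;>
    simp [coe_hermOf, Matrix.mul_apply, Fin.sum_univ_two, IsHermScalars.mul_star_self,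
      star_mul_self_scalar, sq, add_smul, mul_smul, add_comm]

end Coordinates

/-! ### The trace pairing and its duality -/

section Pairing

variable {K : Type} [NormedRing K] [StarRing K] [InnerProductSpace ℝ K] [StarModule ℝ K]
  [IsHermScalars K]

theorem pairing_add_right (θ X Y : Herm 2 K) :
    pairing θ (X + Y) = pairing θ X + pairing θ Y := by
  obtain ⟨a, d, b, rfl⟩ := exists_eq_hermOf θ
  obtain ⟨a', d', b', rfl⟩ := exists_eq_hermOf X
  obtain ⟨a'', d'', b'', rfl⟩ := exists_eq_hermOf Y
  simp only [hermOf_add, pairing_hermOf, inner_add_right]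
  ring

theorem pairing_comm (θ X : Herm 2 K) : pairing θ X = pairing X θ := by
  obtain ⟨a, d, b, rfl⟩ := exists_eq_hermOf θ
  obtain ⟨a', d', b', rfl⟩ := exists_eq_hermOf X
  simp only [pairing_hermOf, real_inner_comm b b']
  ring

theorem pairing_smul_right (θ X : Herm 2 K) (r : ℝ) : pairing θ (r • X) = r * pairing θ X := by
  obtain ⟨a, d, b, rfl⟩ := exists_eq_hermOf θ
  obtain ⟨a', d', b', rfl⟩ := exists_eq_hermOf X
  simp only [smul_hermOf, pairing_hermOf, real_inner_smul_right]
  ring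

theorem pairing_add_left (θ η X : Herm 2 K) :
    pairing (θ + η) X = pairing θ X + pairing η X := by
  simp only [pairing_comm _ X, pairing_add_right]

theorem pairing_smul_left (θ X : Herm 2 K) (r : ℝ) : pairing (r • θ) X = r * pairing θ X := by
  simp only [pairing_comm _ X, pairing_smul_right]

theorem pairing_sub_right (θ X Y : Herm 2 K) :
    pairing θ (X - Y) = pairing θ X - pairing θ Y := by
  have := pairing_add_right θ (X - Y) Y
  rw [sub_add_cancel] at this
  linarith

theorem pairing_one_right (θ : Herm 2 K) : pairing θ 1 = tr θ := by
  obtain ⟨a, d, b, rfl⟩ := exists_eq_hermOf θ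
  simp [hermOf_one, pairing_hermOf, tr_hermOf]

/-- `X ↦ ⟨θ|X⟩`, linearly in `θ`. -/
def pairingLinear : Herm 2 K →ₗ[ℝ] Herm 2 K →ₗ[ℝ] ℝ :=
  LinearMap.mk₂ ℝ pairing pairing_add_left (fun r θ X => pairing_smul_left θ X r)
    pairing_add_right (fun r θ X => pairing_smul_right θ X r)

theorem eq_zero_of_pairing_self (θ : Herm 2 K) (h : pairing θ θ = 0) : θ = 0 := by
  obtain ⟨a, d, b, rfl⟩ := exists_eq_hermOf θ
  rw [pairing_hermOf, real_inner_self_eq_norm_sq] at h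
  have ha : a = 0 := by nlinarith [sq_nonneg d, sq_nonneg ‖b‖, sq_nonneg a]
  have hd : d = 0 := by nlinarith [sq_nonneg d, sq_nonneg ‖b‖, sq_nonneg a]
  have hb : ‖b‖ = 0 := by nlinarith [sq_nonneg d, sq_nonneg ‖b‖, sq_nonneg a]
  rw [norm_eq_zero] at hb
  subst ha hd hb
  simpa using (smul_hermOf (0 : ℝ) 0 0 (0 : K)).symm

instance instFiniteDimensionalHerm : FiniteDimensional ℝ (Herm 2 K) :=
  inferInstanceAs (FiniteDimensional ℝ (selfAdjoint.submodule ℝ (Matrix (Fin 2) (Fin 2) K)))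

/-- The pairing is positive definite, so it embeds the space in its dual, and the dimensions agree.
-/
theorem exists_pairing_eq (L : Herm 2 K →ₗ[ℝ] ℝ) : ∃ θ : Herm 2 K, ∀ X, L X = pairing θ X := by
  have hinj : Function.Injective (pairingLinear (K := K)) := by
    rw [injective_iff_map_eq_zero]
    intro θ hθ
    exact eq_zero_of_pairing_self θ (LinearMap.congr_fun hθ θ)
  have hsurj := (LinearMap.injective_iff_surjective_of_finrank_eq_finrank
    (Subspace.dual_finrank_eq (K := ℝ) (V := Herm 2 K)).symm).1 hinj
  obtain ⟨θ, hθ⟩ := hsurj L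
  exact ⟨θ, fun X => by rw [← hθ]; rfl⟩

instance instContinuousSMulHerm : ContinuousSMul ℝ (Herm 2 K) :=
  ⟨Continuous.subtype_mk (continuous_fst.smul (continuous_subtype_val.comp continuous_snd)) _⟩

/-- Second countability makes the product of Borel σ-algebras Borel, so sums and differences of the
two coordinates are measurable. -/
instance instSecondCountableHerm : SecondCountableTopology (Herm 2 K) :=
  (toEuclidean (E := Herm 2 K)).toHomeomorph.isEmbedding.secondCountableTopology

theorem continuous_pairing (θ : Herm 2 K) : Continuous (pairing θ) :=
  (pairingLinear θ).continuous_of_finiteDimensional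

theorem measurable_pairing (θ : Herm 2 K) : Measurable (pairing θ) :=
  (continuous_pairing θ).measurable

theorem exists_inner_entry_eq_pairing (i j : Fin 2) (k : K) :
    ∃ η : Herm 2 K, ∀ X : Herm 2 K,
      inner ℝ k ((X : Matrix (Fin 2) (Fin 2) K) i j) = pairing η X := by
  let L : Herm 2 K →ₗ[ℝ] ℝ :=
    { toFun := fun X => inner ℝ k ((X : Matrix (Fin 2) (Fin 2) K) i j)
      map_add' := fun X Y => by
        rw [AddSubgroup.coe_add, Matrix.add_apply, inner_add_right]
      map_smul' := fun r X => by
        rw [selfAdjoint.val_smul, Matrix.smul_apply, real_inner_smul_right]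
        rfl }
  exact exists_pairing_eq L

end Pairing

/-! ### The quadratic polynomial along lines -/

section GammaPoly

variable {K : Type} [NormedRing K] [StarRing K] [InnerProductSpace ℝ K] [StarModule ℝ K]

/-- The quadratic part `β tr² θ + 4 det θ` of `gammaPoly`. -/
def gammaQuad (β : ℝ) (θ : Herm 2 K) : ℝ := β * tr θ ^ 2 + 4 * det θ

/-- The derivative of `gammaPoly` at `θ` in direction `η`. -/
def gammaDeriv (β c : ℝ) (θ η : Herm 2 K) : ℝ :=
  gammaPoly β c (θ + η) - gammaPoly β c θ - gammaQuad β η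

variable [IsHermScalars K]

/-- The Taylor expansion is exact because `gammaPoly` is quadratic; the polarization `gammaDeriv` is
its linear coefficient. -/
theorem gammaPoly_line (β c s : ℝ) (θ η : Herm 2 K) :
    gammaPoly β c (θ + s • η) =
      gammaPoly β c θ + s * gammaDeriv β c θ η + s ^ 2 * gammaQuad β η := by
  obtain ⟨a, d, b, rfl⟩ := exists_eq_hermOf θ
  obtain ⟨a', d', b', rfl⟩ := exists_eq_hermOf η
  simp only [gammaDeriv, gammaPoly, gammaQuad, hermOf_add, smul_hermOf, tr_hermOf, det_hermOf,
    norm_add_sq_real, norm_smul, mul_pow, Real.norm_eq_abs, sq_abs, real_inner_smul_right]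
  ring

omit [StarModule ℝ K] [IsHermScalars K] in
theorem gammaPoly_zero (β c : ℝ) : gammaPoly β c (0 : Herm 2 K) = 1 := by
  simp [gammaPoly, tr, det, re]

theorem gammaDeriv_zero (β c : ℝ) (η : Herm 2 K) :
    gammaDeriv β c 0 η = -(2 * c * √(1 + β)) * pairing η 1 := by
  rw [gammaDeriv, gammaPoly_zero, zero_add, gammaPoly, gammaQuad, pairing_one_right]
  ring

theorem tr_line (s : ℝ) (θ η : Herm 2 K) : tr (θ + s • η) = tr θ + s * tr η := by
  simp only [← pairing_one_right, pairing_add_left, pairing_smul_left]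

omit [StarModule ℝ K] [IsHermScalars K] in
theorem zero_mem_gammaDomain {β c : ℝ} (hc : 1 < c) : (0 : Herm 2 K) ∈ gammaDomain β c := by
  refine ⟨?_, by rw [gammaPoly_zero]; norm_num⟩
  simp [tr, re]; linarith

theorem eventually_mem_gammaDomain {β c : ℝ} {θ : Herm 2 K} (hθ : θ ∈ gammaDomain β c)
    (η : Herm 2 K) : ∀ᶠ s in nhds (0 : ℝ), θ + s • η ∈ gammaDomain β c := by
  have h1 : ∀ᶠ s : ℝ in nhds 0, √(1 + β) * (tr θ + s * tr η) < c := by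
    refine ContinuousAt.eventually_lt (by fun_prop) continuousAt_const ?_
    simpa using hθ.1
  have h2 : ∀ᶠ s : ℝ in nhds 0, 0 < gammaPoly β c θ + s * gammaDeriv β c θ η +
      s ^ 2 * gammaQuad β η := by
    refine ContinuousAt.eventually_lt continuousAt_const (by fun_prop) ?_
    simpa using hθ.2
  filter_upwards [h1, h2] with s hs1 hs2
  refine ⟨by rwa [tr_line], by rwa [gammaPoly_line]⟩

end GammaPoly

/-! ### Unitary conjugation -/

section Rotation

variable {K : Type} [NormedRing K] [StarRing K] [InnerProductSpace ℝ K] [StarModule ℝ K]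
  [IsHermScalars K]

omit [StarModule ℝ K] in
theorem re_trace_mul_comm (A B : Matrix (Fin 2) (Fin 2) K) :
    re (Matrix.trace (A * B)) = re (Matrix.trace (B * A)) := by
  simp only [Matrix.trace_fin_two, Matrix.mul_apply, Fin.sum_univ_two, re_add]
  rw [IsHermScalars.re_mul_comm (A 0 0), IsHermScalars.re_mul_comm (A 0 1),
    IsHermScalars.re_mul_comm (A 1 0), IsHermScalars.re_mul_comm (A 1 1)]
  ring

omit [StarModule ℝ K] in
theorem pairing_rotate (U : Matrix (Fin 2) (Fin 2) K) (θ X : Herm 2 K) :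
    pairing θ (rotate U X) = pairing (rotate (star U) θ) X := by
  simp only [pairing, rotate, star_star]
  rw [← mul_assoc, re_trace_mul_comm, ← mul_assoc, ← mul_assoc, mul_assoc (star U * _)]

omit [InnerProductSpace ℝ K] [StarModule ℝ K] [IsHermScalars K] in
theorem rotate_rotate (U V : Matrix (Fin 2) (Fin 2) K) (X : Herm 2 K) :
    rotate U (rotate V X) = rotate (U * V) X := by
  apply Subtype.ext
  simp only [rotate, star_mul, mul_assoc]

omit [InnerProductSpace ℝ K] [StarModule ℝ K] [IsHermScalars K] in
theorem rotate_one (X : Herm 2 K) : rotate 1 X = X := by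
  apply Subtype.ext
  simp [rotate]

omit [InnerProductSpace ℝ K] [StarModule ℝ K] [IsHermScalars K] in
theorem rotate_unitary_one {U : Matrix (Fin 2) (Fin 2) K} (hU : U ∈ unitary _) :
    rotate U (1 : Herm 2 K) = 1 := by
  apply Subtype.ext
  simp [rotate, (Unitary.mem_iff.1 hU).2]

/-- Expresses the determinant through the trace and the norm, whose unitary invariance follows from
`re (tr (AB)) = re (tr (BA))`, over noncommutative scalars too. -/
theorem four_mul_det (θ : Herm 2 K) : 4 * det θ = 2 * (tr θ ^ 2 - pairing θ θ) := by
  obtain ⟨a, d, b, rfl⟩ := exists_eq_hermOf θ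
  rw [det_hermOf, tr_hermOf, pairing_hermOf, real_inner_self_eq_norm_sq]
  ring

theorem tr_rotate {U : Matrix (Fin 2) (Fin 2) K} (hU : U ∈ unitary _) (θ : Herm 2 K) :
    tr (rotate U θ) = tr θ := by
  rw [← pairing_one_right, pairing_comm, pairing_rotate, rotate_unitary_one
    (Unitary.star_mem hU), pairing_comm, pairing_one_right]

theorem gammaPoly_rotate {U : Matrix (Fin 2) (Fin 2) K} (hU : U ∈ unitary _) (β c : ℝ)
    (θ : Herm 2 K) : gammaPoly β c (rotate U θ) = gammaPoly β c θ := by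
  have h : pairing (rotate U θ) (rotate U θ) = pairing θ θ := by
    rw [pairing_rotate, rotate_rotate, (Unitary.mem_iff.1 hU).1, rotate_one]
  rw [gammaPoly, gammaPoly, four_mul_det, four_mul_det, tr_rotate hU, h]

theorem rotate_mem_gammaDomain {U : Matrix (Fin 2) (Fin 2) K} (hU : U ∈ unitary _) {β c : ℝ}
    {θ : Herm 2 K} (hθ : θ ∈ gammaDomain β c) : rotate U θ ∈ gammaDomain β c := by
  refine ⟨?_, ?_⟩
  · rw [tr_rotate hU]; exact hθ.1
  · rw [gammaPoly_rotate hU]; exact hθ.2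

omit [InnerProductSpace ℝ K] [StarModule ℝ K] [IsHermScalars K] in
theorem continuous_rotate (U : Matrix (Fin 2) (Fin 2) K) :
    Continuous (rotate U : Herm 2 K → Herm 2 K) :=
  Continuous.subtype_mk ((continuous_const.mul continuous_subtype_val).mul continuous_const) _

end Rotation

/-! ### Entries of `X²` as sums of squares of linear forms -/

section Squares

variable {K : Type} [NormedRing K] [StarRing K] [InnerProductSpace ℝ K] [StarModule ℝ K]
  [IsHermScalars K]

theorem gammaQuad_hermOf (β a d : ℝ) (b : K) :
    gammaQuad β (hermOf a d b) = β * (a + d) ^ 2 + 4 * (a * d - ‖b‖ ^ 2) := by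
  rw [gammaQuad, tr_hermOf, det_hermOf]

/-- Every real coordinate of `X²` is a combination of squares of linear forms `⟨η|X⟩` whose
`gammaQuad` traces vanish, when `β` is the dimension of the scalars. -/
theorem exists_sq_entry_eq_sum {β : ℝ} (hβ : (Module.finrank ℝ K : ℝ) = β) (i j : Fin 2) (k : K) :
    ∃ (m : ℕ) (w : Fin m → ℝ) (η : Fin m → Herm 2 K),
      (∀ X : Herm 2 K, inner ℝ k (((X : Matrix (Fin 2) (Fin 2) K) ^ 2) i j) =
        ∑ l, w l * pairing (η l) X ^ 2) ∧ ∑ l, w l * gammaQuad β (η l) = 0 := by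
  have hoff : ∀ k : K, ∃ (m : ℕ) (w : Fin m → ℝ) (η : Fin m → Herm 2 K),
      (∀ (a d : ℝ) (b : K), inner ℝ k ((a + d) • b) =
        ∑ l, w l * pairing (η l) (hermOf a d b) ^ 2) ∧ ∑ l, w l * gammaQuad β (η l) = 0 := by
    intro k
    -- Polarization: the two forms are `(a + d) ± ⟨k|b⟩`, and their squares differ by `4(a +
    -- d)⟨k|b⟩`. The two matrices differ only in the sign of the off-diagonal entry, so they have
    -- equal `gammaQuad`.
    refine ⟨2, ![1 / 4, -1 / 4],
      ![hermOf 1 1 ((1 / 2 : ℝ) • k), hermOf 1 1 (-(1 / 2 : ℝ) • k)], fun a d b => ?_, ?_⟩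
    · simp [Fin.sum_univ_two, pairing_hermOf, real_inner_smul_left, real_inner_smul_right]
      ring
    · simp [Fin.sum_univ_two, gammaQuad_hermOf, norm_smul]
      ring
  have hdiag : ∀ ε : Bool, ∃ (m : ℕ) (w : Fin m → ℝ) (η : Fin m → Herm 2 K),
      (∀ (a d : ℝ) (b : K), re k * ((if ε then a else d) ^ 2 + ‖b‖ ^ 2) =
        ∑ l, w l * pairing (η l) (hermOf a d b) ^ 2) ∧ ∑ l, w l * gammaQuad β (η l) = 0 := by
    intro ε
    -- The diagonal unit contributes `β` to `gammaQuad`. Each off-diagonal matrix contributes `-4 ·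
    -- (1/2)² = -1`, and there are `dim K = β` of them. The factor `1/2` offsets the doubling of the
    -- off-diagonal entry in the pairing.
    refine ⟨Module.finrank ℝ K + 1, fun _ => re k,
      Fin.cons (if ε then hermOf 1 0 0 else hermOf 0 1 0)
        (fun l => hermOf 0 0 ((1 / 2 : ℝ) • stdOrthonormalBasis ℝ K l)), fun a d b => ?_, ?_⟩
    · have := (stdOrthonormalBasis ℝ K).sum_sq_inner_right b
      cases ε <;>
      simp [Fin.sum_univ_succ, pairing_hermOf, real_inner_smul_left, ← Finset.mul_sum, this]
    · cases ε <;>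
      simp [Fin.sum_univ_succ, gammaQuad_hermOf, norm_smul, hβ] <;> ring
  fin_cases i <;> fin_cases j
  · obtain ⟨m, w, η, h, h'⟩ := hdiag true
    refine ⟨m, w, η, fun X => ?_, h'⟩
    obtain ⟨a, d, b, rfl⟩ := exists_eq_hermOf X
    rw [← h, sq_hermOf]
    simp [coe_hermOf, real_inner_smul_right, inner_one_right]
    ring
  · obtain ⟨m, w, η, h, h'⟩ := hoff k
    refine ⟨m, w, η, fun X => ?_, h'⟩
    obtain ⟨a, d, b, rfl⟩ := exists_eq_hermOf X
    rw [← h, sq_hermOf]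
    rfl
  · obtain ⟨m, w, η, h, h'⟩ := hoff (star k)
    refine ⟨m, w, η, fun X => ?_, h'⟩
    obtain ⟨a, d, b, rfl⟩ := exists_eq_hermOf X
    rw [← h, sq_hermOf, ← inner_star_right]
    rfl
  · obtain ⟨m, w, η, h, h'⟩ := hdiag false
    refine ⟨m, w, η, fun X => ?_, h'⟩
    obtain ⟨a, d, b, rfl⟩ := exists_eq_hermOf X
    rw [← h, sq_hermOf]
    simp [coe_hermOf, real_inner_smul_right, inner_one_right]
    ring

end Squares

/-! ### Integrals against a truncated real density -/

section WithDensity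

variable {Ω : Type*} [MeasurableSpace Ω] {μ : Measure Ω} {g f : Ω → ℝ}

theorem integrable_withDensity_ofReal (hg : Measurable g) :
    Integrable f (μ.withDensity fun ω => ENNReal.ofReal (g ω)) ↔
      Integrable (fun ω => max (g ω) 0 * f ω) μ := by
  rw [integrable_withDensity_iff_integrable_smul' hg.ennreal_ofReal (by simp)]
  simp only [ENNReal.toReal_ofReal', smul_eq_mul]

theorem integral_withDensity_ofReal (hg : Measurable g) :
    ∫ ω, f ω ∂(μ.withDensity fun ω => ENNReal.ofReal (g ω)) = ∫ ω, max (g ω) 0 * f ω ∂μ := by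
  rw [integral_withDensity_eq_integral_toReal_smul hg.ennreal_ofReal (by simp)]
  simp only [ENNReal.toReal_ofReal', smul_eq_mul]

end WithDensity

/-! ### Uniqueness of Laplace transforms near the origin -/

section Uniqueness

/-- Moment generating functions that agree near `0` determine the characteristic function. -/
theorem complexMGF_I_eq_of_eventually_mgf_eq {Ω Ω' : Type*} [MeasurableSpace Ω]
    [MeasurableSpace Ω'] {μ : Measure Ω} {μ' : Measure Ω'} {X : Ω → ℝ} {Y : Ω' → ℝ}
    (hX : ∀ᶠ s in nhds (0 : ℝ), s ∈ integrableExpSet X μ)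
    (hY : ∀ᶠ s in nhds (0 : ℝ), s ∈ integrableExpSet Y μ')
    (h : ∀ᶠ s in nhds (0 : ℝ), mgf X μ s = mgf Y μ' s) :
    complexMGF X μ Complex.I = complexMGF Y μ' Complex.I := by
  set I : Set ℝ := interior (integrableExpSet X μ) ∩ interior (integrableExpSet Y μ')
  have h0 : (0 : ℝ) ∈ I := ⟨mem_interior_iff_mem_nhds.2 hX, mem_interior_iff_mem_nhds.2 hY⟩
  have hconv : Convex ℝ I := convex_integrableExpSet.interior.inter convex_integrableExpSet.interior
  -- Identity theorem on a vertical strip around the imaginary axis: the two functions agree at real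
  -- points accumulating at `0`, and the strip contains `I`.
  have key := AnalyticOnNhd.eqOn_of_preconnected_of_frequently_eq
    (f := complexMGF X μ) (g := complexMGF Y μ') (U := {z : ℂ | z.re ∈ I}) (z₀ := 0)
    (analyticOnNhd_complexMGF.mono fun z hz => hz.1)
    (analyticOnNhd_complexMGF.mono fun z hz => hz.2)
    (hconv.linear_preimage Complex.reLm).isPreconnected
    (by simpa using h0) ?_
  · exact key (by simpa using h0)
  · have htend : Filter.Tendsto (fun x : ℝ => (x : ℂ)) (nhdsWithin 0 {0}ᶜ)
        (nhdsWithin 0 {0}ᶜ) := by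
      refine tendsto_nhdsWithin_of_tendsto_nhds_of_eventually_within _
        ((Complex.continuous_ofReal.tendsto' 0 0 (by simp)).mono_left nhdsWithin_le_nhds) ?_
      filter_upwards [self_mem_nhdsWithin] with x hx
      simpa using hx
    refine htend.frequently (Filter.Eventually.frequently ?_)
    filter_upwards [nhdsWithin_le_nhds h] with x hx
    rw [complexMGF_ofReal, complexMGF_ofReal, hx]

variable {K : Type} [NormedRing K] [StarRing K] [InnerProductSpace ℝ K] [StarModule ℝ K]
  [IsHermScalars K]

/-- A finite measure on self-adjoint matrices is determined by its Laplace transform near `0`. -/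
theorem ext_of_eventually_mgf_pairing_eq {μ ν : Measure (Herm 2 K)} [IsFiniteMeasure μ]
    [IsFiniteMeasure ν]
    (hμ : ∀ θ, ∀ᶠ s in nhds (0 : ℝ), s ∈ integrableExpSet (pairing θ) μ)
    (hν : ∀ θ, ∀ᶠ s in nhds (0 : ℝ), s ∈ integrableExpSet (pairing θ) ν)
    (h : ∀ θ, ∀ᶠ s in nhds (0 : ℝ), mgf (pairing θ) μ s = mgf (pairing θ) ν s) : μ = ν := by
  let e := (toEuclidean (E := Herm 2 K)).toHomeomorph.toMeasurableEquiv
  have he : ∀ X, e X = toEuclidean X := fun _ => rfl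
  apply e.map_measurableEquiv_injective
  -- A functional on the Euclidean copy pulls back to some `pairing θ`, so the one-dimensional
  -- statement applies to each functional separately.
  refine Measure.ext_of_charFunDual (funext fun L => ?_)
  obtain ⟨θ, hθ⟩ := exists_pairing_eq
    (L.toLinearMap ∘ₗ (toEuclidean (E := Herm 2 K)).toLinearEquiv.toLinearMap)
  have hθ' : ∀ X, L (e X) = pairing θ X := hθ
  have key := complexMGF_I_eq_of_eventually_mgf_eq (hμ θ) (hν θ) (h θ)
  simp only [complexMGF] at key
  rw [charFunDual_apply, charFunDual_apply, integral_map_equiv, integral_map_equiv]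
  simp only [hθ', mul_comm _ Complex.I]
  exact key

/-- If `E (G e^⟨θ|S⟩) = 0` for all `θ` near `0`, then `E (G | S) = 0`. -/
theorem setIntegral_preimage_eq_zero_of_integral_mul_exp {Ω : Type*} [MeasurableSpace Ω]
    {P : Measure Ω} [IsFiniteMeasure P] {S : Ω → Herm 2 K} (hS : Measurable S) {G : Ω → ℝ}
    (hG : Measurable G) (hGi : Integrable G P)
    (hint : ∀ θ, ∀ᶠ s in nhds (0 : ℝ),
      Integrable (fun ω => G ω * Real.exp (s * pairing θ (S ω))) P)
    (hzero : ∀ θ, ∀ᶠ s in nhds (0 : ℝ), ∫ ω, G ω * Real.exp (s * pairing θ (S ω)) ∂P = 0)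
    {B : Set (Herm 2 K)} (hB : MeasurableSet B) : ∫ ω in S ⁻¹' B, G ω ∂P = 0 := by
  -- `ENNReal.ofReal` cuts off negative values, so `ν G` and `ν (-G)` are the images under `S` of
  -- the positive and negative parts of `G`. The vanishing integrals say that their Laplace
  -- transforms agree.
  let ν : (Ω → ℝ) → Measure (Herm 2 K) :=
    fun g => (P.withDensity fun ω => ENNReal.ofReal (g ω)).map S
  have hfin : ∀ g : Ω → ℝ, Integrable g P → IsFiniteMeasure (ν g) := fun g hg => by
    have : IsFiniteMeasure (P.withDensity fun ω => ENNReal.ofReal (g ω)) :=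
      isFiniteMeasure_withDensity_ofReal hg.2
    exact Measure.isFiniteMeasure_map _ _
  have hexp : ∀ (θ : Herm 2 K) (s : ℝ), Measurable fun X => Real.exp (s * pairing θ X) :=
    fun θ s => ((measurable_pairing θ).const_mul s).exp
  have hmax : ∀ (g : Ω → ℝ) θ s, Measurable g →
      Integrable (fun ω => g ω * Real.exp (s * pairing θ (S ω))) P →
      Integrable (fun ω => max (g ω) 0 * Real.exp (s * pairing θ (S ω))) P := by
    intro g θ s hg h
    refine h.mono ((hg.max measurable_const).mul ((hexp θ s).comp hS)).aestronglyMeasurable ?_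
    refine Filter.Eventually.of_forall fun ω => ?_
    rw [norm_mul, norm_mul]
    refine mul_le_mul_of_nonneg_right ?_ (norm_nonneg _)
    rw [Real.norm_eq_abs, Real.norm_eq_abs, abs_of_nonneg (le_max_right _ _)]
    exact max_le (le_abs_self _) (abs_nonneg _)
  have hset : ∀ (g : Ω → ℝ) θ s, Measurable g →
      Integrable (fun ω => g ω * Real.exp (s * pairing θ (S ω))) P →
      s ∈ integrableExpSet (pairing θ) (ν g) := by
    intro g θ s hg h
    change Integrable _ _
    rw [integrable_map_measure (hexp θ s).aestronglyMeasurable hS.aemeasurable,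
      integrable_withDensity_ofReal hg]
    exact hmax g θ s hg h
  have hmgf : ∀ (g : Ω → ℝ) θ s, Measurable g → mgf (pairing θ) (ν g) s =
      ∫ ω, max (g ω) 0 * Real.exp (s * pairing θ (S ω)) ∂P := by
    intro g θ s hg
    rw [mgf, integral_map hS.aemeasurable (hexp θ s).aestronglyMeasurable,
      integral_withDensity_ofReal hg]
  have hneg : ∀ θ s, Integrable (fun ω => G ω * Real.exp (s * pairing θ (S ω))) P →
      Integrable (fun ω => -G ω * Real.exp (s * pairing θ (S ω))) P := by
    intro θ s h
    simp only [neg_mul]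
    exact h.neg
  have hpos : ∀ x : ℝ, x = max x 0 - max (-x) 0 := fun x => (max_zero_sub_eq_self x).symm
  have := hfin G hGi
  have := hfin _ hGi.neg
  have hν : ν G = ν (-G) := by
    refine ext_of_eventually_mgf_pairing_eq (fun θ => ?_) (fun θ => ?_) fun θ => ?_
    · filter_upwards [hint θ] with s hs using hset G θ s hG hs
    · filter_upwards [hint θ] with s hs using hset (-G) θ s hG.neg (hneg θ s hs)
    · filter_upwards [hint θ, hzero θ] with s hs h0
      rw [hmgf G θ s hG, hmgf (-G) θ s hG.neg, ← sub_eq_zero,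
        ← integral_sub (hmax G θ s hG hs) (hmax (-G) θ s hG.neg (hneg θ s hs))]
      refine Eq.trans ?_ h0
      refine integral_congr_ae (Filter.Eventually.of_forall fun ω => ?_)
      simp only [Pi.neg_apply]
      rw [← sub_mul, ← hpos]
  have hBval : ∀ g : Ω → ℝ, Measurable g → Integrable g P →
      (ν g).real B = ∫ ω in S ⁻¹' B, max (g ω) 0 ∂P := by
    intro g hg hgi
    rw [measureReal_def, Measure.map_apply hS hB, withDensity_apply _ (hS hB),
      integral_eq_lintegral_of_nonneg_ae
        (f := fun ω => max (g ω) 0) (Filter.Eventually.of_forall fun ω => le_max_right _ _)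
        (hg.max measurable_const).aestronglyMeasurable]
    simp only [ENNReal.ofReal_max, ENNReal.ofReal_zero]
    simp
  have h1 := hBval G hG hGi
  have h2 := hBval (-G) hG.neg hGi.neg
  rw [hν, h2] at h1
  rw [show ∫ ω in S ⁻¹' B, G ω ∂P = ∫ ω in S ⁻¹' B, (max (G ω) 0 - max (-G ω) 0) ∂P by
    simp only [← hpos], integral_sub hGi.pos_part.integrableOn hGi.neg_part.integrableOn, ← h1]
  simp

end Uniqueness

/-! ### Exponentially weighted moments of linear forms -/

section Moments

variable {K : Type} [NormedRing K] [StarRing K] [InnerProductSpace ℝ K] [StarModule ℝ K]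
  [IsHermScalars K] {β p c : ℝ} {μ : Measure (Herm 2 K)} {θ : Herm 2 K}

theorem measurable_exp_pairing (θ : Herm 2 K) : Measurable fun X => Real.exp (pairing θ X) :=
  (measurable_pairing θ).exp

theorem IsGammaEnsemble.integrable_exp (h : IsGammaEnsemble β p c μ)
    (hθ : θ ∈ gammaDomain β c) : Integrable (fun X => Real.exp (pairing θ X)) μ := by
  refine ⟨(measurable_exp_pairing θ).aestronglyMeasurable, ?_⟩
  rw [hasFiniteIntegral_iff_ofReal (Filter.Eventually.of_forall fun _ => (Real.exp_pos _).le)]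
  have := h.laplace_eq θ hθ
  rw [laplace] at this
  rw [this]
  exact ENNReal.ofReal_lt_top

theorem IsGammaEnsemble.integral_exp (h : IsGammaEnsemble β p c μ)
    (hθ : θ ∈ gammaDomain β c) :
    ∫ X, Real.exp (pairing θ X) ∂μ = gammaPoly β c θ ^ (-p) := by
  rw [integral_eq_lintegral_of_nonneg_ae (Filter.Eventually.of_forall fun _ => (Real.exp_pos _).le)
    (measurable_exp_pairing θ).aestronglyMeasurable]
  have := h.laplace_eq θ hθ
  rw [laplace] at this
  rw [this, ENNReal.toReal_ofReal (Real.rpow_nonneg hθ.2.le _)]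

/-- The derivative of the power `-p` of a quadratic polynomial. -/
theorem hasDerivAt_quadratic_rpow_neg (p P A B s : ℝ) (hs : 0 < P + s * A + s ^ 2 * B) :
    HasDerivAt (fun s : ℝ => (P + s * A + s ^ 2 * B) ^ (-p))
      ((A + 2 * s * B) * (-p) * (P + s * A + s ^ 2 * B) ^ (-p - 1)) s := by
  have h : HasDerivAt (fun s : ℝ => P + s * A + s ^ 2 * B) (A + 2 * s * B) s := by
    have h1 := ((hasDerivAt_id s).mul_const A).const_add P
    have h2 := ((hasDerivAt_id s).pow 2).mul_const B
    exact (h1.add h2).congr_deriv (by simp)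
  exact h.rpow_const (Or.inl hs.ne')

theorem IsGammaEnsemble.moments (h : IsGammaEnsemble β p c μ) (hθ : θ ∈ gammaDomain β c)
    (η : Herm 2 K) :
    (∀ n : ℕ, Integrable (fun X => pairing η X ^ n * Real.exp (pairing θ X)) μ) ∧
    ∫ X, pairing η X * Real.exp (pairing θ X) ∂μ =
      -p * gammaPoly β c θ ^ (-p - 1) * gammaDeriv β c θ η ∧
    ∫ X, pairing η X ^ 2 * Real.exp (pairing θ X) ∂μ =
      p * (p + 1) * gammaPoly β c θ ^ (-p - 2) * gammaDeriv β c θ η ^ 2 -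
        2 * p * gammaPoly β c θ ^ (-p - 1) * gammaQuad β η := by
  -- The unnormalized exponential tilt: the required integrals are the moments of `pairing η` under
  -- `τ`, read off from its moment generating function at `0`.
  let τ := μ.withDensity fun X => ENNReal.ofReal (Real.exp (pairing θ X))
  have hm := measurable_exp_pairing θ
  have hmax : ∀ X : Herm 2 K, max (Real.exp (pairing θ X)) 0 = Real.exp (pairing θ X) :=
    fun X => max_eq_left (Real.exp_pos _).le
  have hint : ∀ f : Herm 2 K → ℝ, Integrable f τ ↔
      Integrable (fun X => f X * Real.exp (pairing θ X)) μ := fun f => by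
    rw [integrable_withDensity_ofReal hm]
    simp only [hmax, mul_comm]
  have hval : ∀ f : Herm 2 K → ℝ, ∫ X, f X ∂τ = ∫ X, f X * Real.exp (pairing θ X) ∂μ :=
    fun f => by
      rw [integral_withDensity_ofReal hm]
      simp only [hmax, mul_comm]
  have hexp : ∀ s : ℝ, (fun X => Real.exp (s * pairing η X) * Real.exp (pairing θ X)) =
      fun X => Real.exp (pairing (θ + s • η) X) := fun s => by
    funext X
    rw [← Real.exp_add, pairing_add_left, pairing_smul_left, add_comm]
  have hdom := eventually_mem_gammaDomain hθ η
  have hset : ∀ᶠ s in nhds (0 : ℝ), s ∈ integrableExpSet (pairing η) τ := by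
    filter_upwards [hdom] with s hs
    change Integrable _ _
    rw [hint, hexp]
    exact h.integrable_exp hs
  have hmgf : ∀ᶠ s in nhds (0 : ℝ), mgf (pairing η) τ s =
      (gammaPoly β c θ + s * gammaDeriv β c θ η + s ^ 2 * gammaQuad β η) ^ (-p) := by
    filter_upwards [hdom] with s hs
    rw [mgf, hval, hexp, h.integral_exp hs, gammaPoly_line]
  have hpos : ∀ᶠ s in nhds (0 : ℝ),
      0 < gammaPoly β c θ + s * gammaDeriv β c θ η + s ^ 2 * gammaQuad β η := by
    filter_upwards [hdom] with s hs
    rw [← gammaPoly_line]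
    exact hs.2
  -- The first derivative is needed on a neighbourhood of `0`, not only at `0`, so that it can be
  -- differentiated again.
  have hmom : ∀ᶠ s in nhds (0 : ℝ), ∫ X, pairing η X * Real.exp (s * pairing η X) ∂τ =
      (gammaDeriv β c θ η + 2 * s * gammaQuad β η) * (-p) *
        (gammaPoly β c θ + s * gammaDeriv β c θ η + s ^ 2 * gammaQuad β η) ^ (-p - 1) := by
    filter_upwards [hset.eventually_nhds, hmgf.eventually_nhds, hpos] with s h1 h2 h3
    refine (hasDerivAt_mgf (mem_interior_iff_mem_nhds.2 h1)).unique ?_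
    exact (hasDerivAt_quadratic_rpow_neg p _ _ _ s h3).congr_of_eventuallyEq h2
  have h0 : (0 : ℝ) ∈ interior (integrableExpSet (pairing η) τ) := mem_interior_iff_mem_nhds.2 hset
  refine ⟨fun n => ?_, ?_, ?_⟩
  · rw [← hint]
    simpa using integrable_pow_mul_exp_of_mem_interior_integrableExpSet h0 n
  · have := hmom.self_of_nhds
    rw [← hval]
    simp at this
    rw [this]; ring
  · have h2 := hasDerivAt_integral_pow_mul_exp_real h0 1
    simp only [pow_one, zero_mul, Real.exp_zero, mul_one] at h2
    -- The first derivative carries the power `-p - 1 = -(p + 1)`, hence the exponent `p + 1` here.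
    have hq := hasDerivAt_quadratic_rpow_neg (p + 1) _ _ (gammaQuad β η) 0 hpos.self_of_nhds
    have hl : HasDerivAt (fun s : ℝ => (gammaDeriv β c θ η + 2 * s * gammaQuad β η) * (-p))
        (2 * gammaQuad β η * (-p)) 0 := by
      have h1 := (((hasDerivAt_id (0 : ℝ)).const_mul 2).mul_const (gammaQuad β η)).const_add
        (gammaDeriv β c θ η)
      simpa using h1.mul_const (-p)
    have h3 := hl.mul hq
    have h4 := h3.congr_of_eventuallyEq
      (f₁ := fun s => ∫ X, pairing η X * Real.exp (s * pairing η X) ∂τ) (by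
        filter_upwards [hmom] with s hs
        rw [hs, Pi.mul_apply, neg_add'])
    rw [← hval, h2.unique h4]
    simp
    rw [show -1 + -p - 1 = -p - 2 by ring, show -1 + -p = -p - 1 by ring]
    ring

end Moments

/-! ### Independent pairs, moments and invariance -/

section Pairs

variable {K : Type} [NormedRing K] [StarRing K] [InnerProductSpace ℝ K] [StarModule ℝ K]
  [IsHermScalars K] {β p c : ℝ} {μ : Measure (Herm 2 K)} {θ : Herm 2 K}

/-- With `A = 1/(1+2p)`, the coefficient of `gammaDeriv²` is proportional to `(1-A)(p+1) - (1+A)p =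
1 - A(1+2p) = 0`, so only the `gammaQuad` term survives. -/
theorem IsGammaEnsemble.integral_pair (h : IsGammaEnsemble β p c μ) (hp : 0 < p)
    (hθ : θ ∈ gammaDomain β c) (η : Herm 2 K) :
    Integrable (fun ω : Herm 2 K × Herm 2 K =>
      (pairing η (ω.1 - ω.2) ^ 2 - 1 / (1 + 2 * p) * pairing η (ω.1 + ω.2) ^ 2) *
        Real.exp (pairing θ (ω.1 + ω.2))) (μ.prod μ) ∧
    ∫ ω : Herm 2 K × Herm 2 K,
      (pairing η (ω.1 - ω.2) ^ 2 - 1 / (1 + 2 * p) * pairing η (ω.1 + ω.2) ^ 2) *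
        Real.exp (pairing θ (ω.1 + ω.2)) ∂(μ.prod μ) =
      -4 * p * (1 - 1 / (1 + 2 * p)) * gammaPoly β c θ ^ (-p) * gammaPoly β c θ ^ (-p - 1) *
        gammaQuad β η := by
  have := h.isProbabilityMeasure
  obtain ⟨hint, hm1, hm2⟩ := h.moments hθ η
  have hm0 := h.integral_exp hθ
  set A := 1 / (1 + 2 * p) with hA
  have hA' : A * (1 + 2 * p) = 1 := by rw [hA]; field_simp
  have h0 : Integrable (fun X => Real.exp (pairing θ X)) μ := h.integrable_exp hθ
  have h1 : Integrable (fun X => pairing η X * Real.exp (pairing θ X)) μ := by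
    simpa using hint 1
  have h2 := hint 2
  have hfun : (fun ω : Herm 2 K × Herm 2 K =>
      (pairing η (ω.1 - ω.2) ^ 2 - A * pairing η (ω.1 + ω.2) ^ 2) *
        Real.exp (pairing θ (ω.1 + ω.2))) = fun ω =>
      (1 - A) * (pairing η ω.1 ^ 2 * Real.exp (pairing θ ω.1) * Real.exp (pairing θ ω.2)) +
      (1 - A) * (Real.exp (pairing θ ω.1) * (pairing η ω.2 ^ 2 * Real.exp (pairing θ ω.2))) -
      2 * (1 + A) * (pairing η ω.1 * Real.exp (pairing θ ω.1) *
        (pairing η ω.2 * Real.exp (pairing θ ω.2))) := by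
    funext ω
    rw [pairing_add_right, pairing_add_right, pairing_sub_right, Real.exp_add]
    ring
  have i1 := (h2.mul_prod h0).const_mul (1 - A)
  have i2 := (h0.mul_prod h2).const_mul (1 - A)
  have i3 := (h1.mul_prod h1).const_mul (2 * (1 + A))
  have i12 : Integrable (fun ω : Herm 2 K × Herm 2 K =>
      (1 - A) * (pairing η ω.1 ^ 2 * Real.exp (pairing θ ω.1) * Real.exp (pairing θ ω.2)) +
      (1 - A) * (Real.exp (pairing θ ω.1) * (pairing η ω.2 ^ 2 * Real.exp (pairing θ ω.2))))
      (μ.prod μ) := i1.add i2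
  rw [hfun]
  refine ⟨i12.sub i3, ?_⟩
  rw [integral_sub i12 i3, integral_add i1 i2, integral_const_mul, integral_const_mul,
    integral_const_mul, integral_prod_mul (fun X => pairing η X ^ 2 * Real.exp (pairing θ X))
      (fun X => Real.exp (pairing θ X)),
    integral_prod_mul (fun X => Real.exp (pairing θ X)) (fun X => pairing η X ^ 2 * Real.exp (pairing θ X)),
    integral_prod_mul (fun X => pairing η X * Real.exp (pairing θ X))
      (fun X => pairing η X * Real.exp (pairing θ X)), hm0, hm1, hm2]
  have e1 : gammaPoly β c θ ^ (-p) = gammaPoly β c θ ^ (-p - 2) * gammaPoly β c θ ^ 2 := by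
    rw [← Real.rpow_natCast, ← Real.rpow_add hθ.2]; norm_num
  have e2 : gammaPoly β c θ ^ (-p - 1) = gammaPoly β c θ ^ (-p - 2) * gammaPoly β c θ := by
    conv_rhs => rw [← Real.rpow_one (gammaPoly β c θ), ← Real.rpow_mul hθ.2.le,
      ← Real.rpow_add hθ.2]
    norm_num
    congr 1
    ring
  rw [e1, e2]
  generalize gammaPoly β c θ ^ (-p - 2) = r
  linear_combination (-2 * p * r ^ 2 * gammaPoly β c θ ^ 2 *
    gammaDeriv β c θ η ^ 2) * hA'

omit [StarModule ℝ K] in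
variable (K) in
-- Expansion in an orthonormal basis reduces integrability of `K`-valued entries to that of real
-- linear forms.
theorem memLp_of_inner {Ω : Type*} [MeasurableSpace Ω] {P : Measure Ω} {q : ℝ≥0∞} {f : Ω → K}
    (h : ∀ k : K, MemLp (fun ω => inner ℝ k (f ω)) q P) : MemLp f q P := by
  have hf : f = fun ω => ∑ l, inner ℝ (stdOrthonormalBasis ℝ K l) (f ω) •
      stdOrthonormalBasis ℝ K l := by
    funext ω
    exact ((stdOrthonormalBasis ℝ K).sum_repr' (f ω)).symm
  rw [hf]
  exact memLp_finsetSum _ fun l _ =>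
    (ContinuousLinearMap.toSpanSingleton ℝ (stdOrthonormalBasis ℝ K l)).comp_memLp' (h _)

omit [StarModule ℝ K] in
theorem integrable_of_inner {Ω : Type*} [MeasurableSpace Ω] {P : Measure Ω} {f : Ω → K}
    (h : ∀ k : K, Integrable (fun ω => inner ℝ k (f ω)) P) : Integrable f P :=
  memLp_one_iff_integrable.1 (memLp_of_inner K fun k => memLp_one_iff_integrable.2 (h k))

theorem IsGammaEnsemble.moments_zero (h : IsGammaEnsemble β p c μ) (hc : 1 < c) (η : Herm 2 K) :
    Integrable (pairing η) μ ∧ Integrable (fun X => pairing η X ^ 2) μ ∧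
    ∫ X, pairing η X ∂μ = 2 * p * c * √(1 + β) * pairing η 1 ∧
    ∫ X, pairing η X ^ 2 ∂μ =
      p * (p + 1) * (2 * c * √(1 + β)) ^ 2 * pairing η 1 ^ 2 - 2 * p * gammaQuad β η := by
  obtain ⟨hint, hm1, hm2⟩ := h.moments (zero_mem_gammaDomain hc) η
  have h0 : ∀ X : Herm 2 K, Real.exp (pairing 0 X) = 1 := fun X => by
    rw [show (0 : Herm 2 K) = (0 : ℝ) • 0 by simp, pairing_smul_left]
    simp
  simp only [h0, mul_one, gammaPoly_zero, Real.one_rpow, gammaDeriv_zero] at hint hm1 hm2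
  refine ⟨by simpa using hint 1, hint 2, by rw [hm1]; ring, by rw [hm2]; ring⟩

theorem IsGammaEnsemble.hasSecondMoments (h : IsGammaEnsemble β p c μ) (hc : 1 < c) :
    HasSecondMoments μ := by
  intro i j
  refine memLp_of_inner K fun k => ?_
  obtain ⟨η, hη⟩ := exists_inner_entry_eq_pairing i j k
  simp only [hη]
  rw [memLp_two_iff_integrable_sq (measurable_pairing η).aestronglyMeasurable]
  exact (h.moments_zero hc η).2.1

theorem IsGammaEnsemble.rotationInvariant (h : IsGammaEnsemble β p c μ) (hc : 1 < c) :
    RotationInvariant μ := by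
  intro U hU
  have := h.isProbabilityMeasure
  have hmeas : Measurable (rotate U : Herm 2 K → Herm 2 K) := (continuous_rotate U).measurable
  have : IsProbabilityMeasure (μ.map (rotate U)) :=
    Measure.isProbabilityMeasure_map hmeas.aemeasurable
  have hexp : ∀ (θ : Herm 2 K) (s : ℝ), Measurable fun X => Real.exp (s * pairing θ X) :=
    fun θ s => ((measurable_pairing θ).const_mul s).exp
  have hdom : ∀ θ : Herm 2 K, ∀ᶠ s in nhds (0 : ℝ), s • θ ∈ gammaDomain β c := fun θ => by
    simpa using eventually_mem_gammaDomain (zero_mem_gammaDomain (K := K) (β := β) hc) θ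
  have hrot : ∀ θ X : Herm 2 K, ∀ s : ℝ, Real.exp (s * pairing θ (rotate U X)) =
      Real.exp (pairing (rotate (star U) (s • θ)) X) := fun θ X s => by
    rw [← pairing_rotate, pairing_smul_left]
  have hsU := Unitary.star_mem hU
  -- Rotating `X` by `U` amounts to rotating `θ` by `star U`, which preserves the domain and the
  -- polynomial.
  refine ext_of_eventually_mgf_pairing_eq (fun θ => ?_) (fun θ => ?_) fun θ => ?_
  · filter_upwards [hdom θ] with s hs
    change Integrable _ _
    rw [integrable_map_measure (hexp θ s).aestronglyMeasurable hmeas.aemeasurable]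
    simp only [Function.comp_def, hrot]
    exact h.integrable_exp (rotate_mem_gammaDomain hsU hs)
  · filter_upwards [hdom θ] with s hs
    change Integrable _ _
    simp only [← pairing_smul_left]
    exact h.integrable_exp hs
  · filter_upwards [hdom θ] with s hs
    rw [mgf, mgf, integral_map hmeas.aemeasurable (hexp θ s).aestronglyMeasurable]
    simp only [hrot]
    simp only [← pairing_smul_left]
    rw [h.integral_exp (rotate_mem_gammaDomain hsU hs), h.integral_exp hs, gammaPoly_rotate hsU]

theorem IsGammaEnsemble.integrable_entry (h : IsGammaEnsemble β p c μ) (hc : 1 < c) (i j : Fin 2) :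
    Integrable (fun X : Herm 2 K => (X : Matrix (Fin 2) (Fin 2) K) i j) μ := by
  refine integrable_of_inner fun k => ?_
  obtain ⟨η, hη⟩ := exists_inner_entry_eq_pairing i j k
  simp only [hη]
  exact (h.moments_zero hc η).1

theorem IsGammaEnsemble.mean_eq [CompleteSpace K] (h : IsGammaEnsemble β p c μ) (hc : 1 < c) :
    mean μ = (2 * p * c * √(1 + β)) • (1 : Matrix (Fin 2) (Fin 2) K) := by
  ext i j
  refine ext_inner_left ℝ fun k => ?_
  obtain ⟨η, hη⟩ := exists_inner_entry_eq_pairing i j k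
  rw [mean, Matrix.of_apply, ← integral_inner (h.integrable_entry hc i j)]
  simp only [hη]
  rw [(h.moments_zero hc η).2.2.1, ← hη, Matrix.smul_apply, real_inner_smul_right]
  rfl

variable (hβ : (Module.finrank ℝ K : ℝ) = β)

include hβ

theorem IsGammaEnsemble.integrable_sq_entry (h : IsGammaEnsemble β p c μ) (hc : 1 < c)
    (i j : Fin 2) :
    Integrable (fun X : Herm 2 K => ((X : Matrix (Fin 2) (Fin 2) K) ^ 2) i j) μ := by
  refine integrable_of_inner fun k => ?_
  obtain ⟨m, w, η, hη, -⟩ := exists_sq_entry_eq_sum hβ i j k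
  simp only [hη]
  exact integrable_finsetSum _ fun l _ => (h.moments_zero hc (η l)).2.1.const_mul _

theorem IsGammaEnsemble.secondMoment_eq [CompleteSpace K] (h : IsGammaEnsemble β p c μ) (hc : 1 < c) :
    secondMoment μ =
      (p * (p + 1) * (2 * c * √(1 + β)) ^ 2) • (1 : Matrix (Fin 2) (Fin 2) K) := by
  ext i j
  refine ext_inner_left ℝ fun k => ?_
  obtain ⟨m, w, η, hη, hw⟩ := exists_sq_entry_eq_sum hβ i j k
  -- Once the `gammaQuad` terms cancel, the sum `∑ w_l ⟨η_l|1⟩²` remains; the square formula at `X =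
  -- 1` identifies it with a coordinate of the identity matrix.
  have h1 := hη 1
  rw [selfAdjoint.val_one, one_pow] at h1
  rw [secondMoment, Matrix.of_apply, ← integral_inner (h.integrable_sq_entry hβ hc i j)]
  simp only [hη]
  rw [integral_finsetSum _ fun l _ => (h.moments_zero hc (η l)).2.1.const_mul _,
    Matrix.smul_apply, real_inner_smul_right, h1, Finset.mul_sum]
  simp only [integral_const_mul, (h.moments_zero hc (η _)).2.2.2]
  rw [← sub_eq_zero, ← Finset.sum_sub_distrib]
  refine Eq.trans ?_ (mul_eq_zero_of_right (-2 * p) hw)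
  rw [Finset.mul_sum]
  exact Finset.sum_congr rfl fun l _ => by ring

theorem IsGammaEnsemble.variance_eq [CompleteSpace K] (h : IsGammaEnsemble β p c μ) (hc : 1 < c) :
    variance μ = (4 * p * c ^ 2 * (1 + β)) • (1 : Matrix (Fin 2) (Fin 2) K) := by
  have h0 : √(1 + β) ^ 2 = 1 + β := Real.sq_sqrt (by rw [← hβ]; positivity)
  rw [variance, h.mean_eq hc, h.secondMoment_eq hβ hc, smul_pow, one_pow, ← sub_smul]
  congr 1
  linear_combination 4 * p * c ^ 2 * h0

theorem IsGammaEnsemble.integrable_sq_entry_pair (h : IsGammaEnsemble β p c μ) (hc : 1 < c)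
    (i j : Fin 2) :
    Integrable (fun ω : Herm 2 K × Herm 2 K =>
      (((ω.1 - ω.2 : Herm 2 K) : Matrix (Fin 2) (Fin 2) K) ^ 2) i j) (μ.prod μ) ∧
    Integrable (fun ω : Herm 2 K × Herm 2 K =>
      (((ω.1 + ω.2 : Herm 2 K) : Matrix (Fin 2) (Fin 2) K) ^ 2) i j) (μ.prod μ) := by
  have := h.isProbabilityMeasure
  have key : ∀ (η : Herm 2 K) (r : ℝ), Integrable (fun ω : Herm 2 K × Herm 2 K =>
      (pairing η ω.1 + r * pairing η ω.2) ^ 2) (μ.prod μ) := fun η r => by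
    obtain ⟨h1, h2, -, -⟩ := h.moments_zero hc η
    have h3 := ((h2.comp_fst μ).add ((h1.mul_prod h1).const_mul (2 * r))).add
      ((h2.comp_snd μ).const_mul (r ^ 2))
    refine h3.congr (Filter.Eventually.of_forall fun ω => ?_)
    simp only [Pi.add_apply]
    ring
  constructor
  all_goals
    refine integrable_of_inner fun k => ?_
    obtain ⟨m, w, η, hη, -⟩ := exists_sq_entry_eq_sum hβ i j k
    simp only [hη]
    refine integrable_finsetSum _ fun l _ => Integrable.const_mul ?_ _
  · simpa only [pairing_sub_right, neg_one_mul, ← sub_eq_add_neg] using key (η l) (-1)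
  · simpa only [pairing_add_right, one_mul] using key (η l) 1

theorem IsGammaEnsemble.setIntegral_sq [CompleteSpace K] (h : IsGammaEnsemble β p c μ) (hc : 1 < c) (hp : 0 < p)
    (i j : Fin 2) {B : Set (Herm 2 K)} (hB : MeasurableSet B) :
    ∫ ω in (fun ω : Herm 2 K × Herm 2 K => ω.1 + ω.2) ⁻¹' B,
      (((ω.1 - ω.2 : Herm 2 K) : Matrix (Fin 2) (Fin 2) K) ^ 2) i j ∂(μ.prod μ) =
    ∫ ω in (fun ω : Herm 2 K × Herm 2 K => ω.1 + ω.2) ⁻¹' B, (1 / (1 + 2 * p)) •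
      (((ω.1 + ω.2 : Herm 2 K) : Matrix (Fin 2) (Fin 2) K) ^ 2) i j ∂(μ.prod μ) := by
  have := h.isProbabilityMeasure
  obtain ⟨hi1, hi2⟩ := h.integrable_sq_entry_pair hβ hc i j
  have hi2' : Integrable (fun ω : Herm 2 K × Herm 2 K => (1 / (1 + 2 * p)) •
      (((ω.1 + ω.2 : Herm 2 K) : Matrix (Fin 2) (Fin 2) K) ^ 2) i j) (μ.prod μ) := hi2.smul _
  refine ext_inner_left ℝ fun k => ?_
  rw [← integral_inner hi1.integrableOn, ← integral_inner hi2'.integrableOn, ← sub_eq_zero,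
    ← integral_sub (hi1.integrableOn.const_inner k) (hi2'.integrableOn.const_inner k)]
  obtain ⟨m, w, η, hη, hw⟩ := exists_sq_entry_eq_sum hβ i j k
  simp only [real_inner_smul_right, hη]
  have hG : ∀ ω : Herm 2 K × Herm 2 K, ∑ l, w l * pairing (η l) (ω.1 - ω.2) ^ 2 -
      1 / (1 + 2 * p) * ∑ l, w l * pairing (η l) (ω.1 + ω.2) ^ 2 =
      ∑ l, w l * (pairing (η l) (ω.1 - ω.2) ^ 2 -
        1 / (1 + 2 * p) * pairing (η l) (ω.1 + ω.2) ^ 2) := fun ω => by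
    rw [Finset.mul_sum, ← Finset.sum_sub_distrib]
    exact Finset.sum_congr rfl fun l _ => by ring
  simp only [hG]
  have hdom : ∀ θ : Herm 2 K, ∀ᶠ s in nhds (0 : ℝ), s • θ ∈ gammaDomain β c := fun θ => by
    simpa using eventually_mem_gammaDomain (zero_mem_gammaDomain (K := K) (β := β) hc) θ
  have hterm : ∀ (θ : Herm 2 K) l, θ ∈ gammaDomain β c → Integrable
      (fun ω : Herm 2 K × Herm 2 K => w l * (pairing (η l) (ω.1 - ω.2) ^ 2 -
        1 / (1 + 2 * p) * pairing (η l) (ω.1 + ω.2) ^ 2) *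
        Real.exp (pairing θ (ω.1 + ω.2))) (μ.prod μ) := fun θ l hθ => by
    simpa only [mul_assoc] using (h.integral_pair hp hθ (η l)).1.const_mul (w l)
  have hS : Measurable fun ω : Herm 2 K × Herm 2 K => ω.1 + ω.2 :=
    measurable_fst.add measurable_snd
  refine setIntegral_preimage_eq_zero_of_integral_mul_exp hS
    (Finset.measurable_fun_sum _ fun l _ => ?_) ?_ (fun θ => ?_) (fun θ => ?_) hB
  · have m1 := (measurable_pairing (η l)).comp
      ((measurable_fst.sub measurable_snd : Measurable fun ω : Herm 2 K × Herm 2 K => ω.1 - ω.2))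
    have m2 := (measurable_pairing (η l)).comp hS
    exact ((m1.pow_const 2).sub ((m2.pow_const 2).const_mul _)).const_mul _
  · have := (hi1.const_inner (𝕜 := ℝ) k).sub (hi2'.const_inner (𝕜 := ℝ) k)
    refine this.congr (Filter.Eventually.of_forall fun ω => ?_)
    simp only [Pi.sub_apply, real_inner_smul_right, hη, hG]
  · filter_upwards [hdom θ] with s hs
    simp only [← pairing_smul_left, Finset.sum_mul]
    exact integrable_finsetSum _ fun l _ => hterm _ l hs
  · filter_upwards [hdom θ] with s hs
    simp only [← pairing_smul_left, Finset.sum_mul]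
    rw [integral_finsetSum _ fun l _ => hterm _ l hs]
    simp only [mul_assoc (w _), integral_const_mul, (h.integral_pair hp hs (η _)).2]
    -- The prefactor is the same for every `η l`, so the sum is that prefactor times `∑ w_l
    -- gammaQuad β (η_l) = 0`.
    refine Eq.trans ?_ (mul_eq_zero_of_right (-4 * p * (1 - 1 / (1 + 2 * p)) *
      gammaPoly β c (s • θ) ^ (-p) * gammaPoly β c (s • θ) ^ (-p - 1)) hw)
    rw [Finset.mul_sum]
    exact Finset.sum_congr rfl fun l _ => by ring

end Pairs

/-! ### Conditional expectations and standardization -/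

section CondExp

variable {K : Type} [NormedRing K] [StarRing K] [InnerProductSpace ℝ K] [StarModule ℝ K]
  [IsHermScalars K] [CompleteSpace K]

/-- The events of the σ-algebra generated by `X + Y` are exactly the preimages of Borel sets, so the
set integrals characterize the conditional expectation. -/
theorem condSqDiffEq_of_setIntegral {μ : Measure (Herm 2 K)} [IsProbabilityMeasure μ]
    {F : Matrix (Fin 2) (Fin 2) K → Matrix (Fin 2) (Fin 2) K}
    (hF : Continuous F)
    (hint : ∀ i j, Integrable (fun ω : Herm 2 K × Herm 2 K =>
      (((ω.1 - ω.2 : Herm 2 K) : Matrix (Fin 2) (Fin 2) K) ^ 2) i j) (μ.prod μ))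
    (hintF : ∀ i j, Integrable (fun ω : Herm 2 K × Herm 2 K =>
      F ((ω.1 + ω.2 : Herm 2 K) : Matrix (Fin 2) (Fin 2) K) i j) (μ.prod μ))
    (hset : ∀ i j (B : Set (Herm 2 K)), MeasurableSet B →
      ∫ ω in (fun ω : Herm 2 K × Herm 2 K => ω.1 + ω.2) ⁻¹' B,
        (((ω.1 - ω.2 : Herm 2 K) : Matrix (Fin 2) (Fin 2) K) ^ 2) i j ∂(μ.prod μ) =
      ∫ ω in (fun ω : Herm 2 K × Herm 2 K => ω.1 + ω.2) ⁻¹' B,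
        F ((ω.1 + ω.2 : Herm 2 K) : Matrix (Fin 2) (Fin 2) K) i j ∂(μ.prod μ)) :
    CondSqDiffEq μ F := by
  intro i j
  have hS : Measurable fun ω : Herm 2 K × Herm 2 K => ω.1 + ω.2 :=
    measurable_fst.add measurable_snd
  have hFij : StronglyMeasurable fun X : Herm 2 K => F (X : Matrix (Fin 2) (Fin 2) K) i j :=
    ((hF.comp continuous_subtype_val).matrix_elem i j).stronglyMeasurable
  refine (ae_eq_condExp_of_forall_setIntegral_eq hS.comap_le (hint i j)
    (fun s _ _ => (hintF i j).integrableOn) ?_ ?_).symm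
  · rintro s ⟨B, hB, rfl⟩ -
    exact (hset i j B hB).symm
  · exact (hFij.comp_measurable (comap_measurable _)).aestronglyMeasurable

theorem isMeixnerEnsemble_of_isGammaEnsemble {β p c : ℝ} {μ : Measure (Herm 2 K)}
    (hβ : (Module.finrank ℝ K : ℝ) = β) (hc : 1 < c) (hp : 0 < p)
    (h : IsGammaEnsemble β p c μ) : IsMeixnerEnsemble μ (1 / (1 + 2 * p)) 0 0 := by
  have := h.isProbabilityMeasure
  refine ⟨this, h.rotationInvariant hc, h.hasSecondMoments hc, ?_⟩
  have hF : ∀ S : Matrix (Fin 2) (Fin 2) K,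
      (1 / (1 + 2 * p)) • S ^ 2 + (0 : ℝ) • S + (0 : ℝ) • 1 = (1 / (1 + 2 * p)) • S ^ 2 := by
    simp
  simp only [hF]
  exact condSqDiffEq_of_setIntegral (by fun_prop)
    (fun i j => (h.integrable_sq_entry_pair hβ hc i j).1)
    (fun i j => (h.integrable_sq_entry_pair hβ hc i j).2.smul (1 / (1 + 2 * p)))
    (fun i j B hB => h.setIntegral_sq hβ hc hp i j hB)

omit [StarModule ℝ K] [CompleteSpace K] in
theorem sq_smul_sub_smul_one (r m : ℝ) (M : Matrix (Fin 2) (Fin 2) K) :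
    (r • (M - m • 1)) ^ 2 = r ^ 2 • (M ^ 2 - (2 * m) • M + m ^ 2 • 1) := by
  simp only [sq, sub_mul, mul_sub, mul_one, one_mul, smul_mul_assoc,
    mul_smul_comm]
  module

omit [StarModule ℝ K] [CompleteSpace K] in
-- Here `b² = 4a`, so `1 + bt + at² = (1 + t/(2√p))²`. The shift `2m = 2σ√p` in `t = (S - 2m)/σ`
-- cancels the constant, leaving `S²/(4pσ²)`. The prefactor is `4p/(1+2p)`.
theorem standardized_meixner_eq_smul {p m σ : ℝ} (hp : 0 < p) (hσ : σ ≠ 0) (hm : m = σ * √p)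
    (S : Matrix (Fin 2) (Fin 2) K) :
    (2 / (1 + 2 * (1 / (4 * p)))) • (1 + (1 / √p) • (σ⁻¹ • (S - (2 * m) • 1)) +
      (1 / (4 * p)) • (σ⁻¹ • (S - (2 * m) • 1)) ^ 2) =
    (σ⁻¹) ^ 2 • ((1 / (1 + 2 * p)) • S ^ 2) := by
  obtain ⟨q, hq, rfl⟩ : ∃ q : ℝ, 0 < q ∧ p = q ^ 2 :=
    ⟨√p, Real.sqrt_pos.2 hp, (Real.sq_sqrt hp.le).symm⟩
  rw [Real.sqrt_sq hq.le] at hm ⊢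
  subst hm
  rw [sq_smul_sub_smul_one]
  match_scalars <;> field_simp <;> ring

theorem isStandardMeixner_standardize {β p c : ℝ} {μ : Measure (Herm 2 K)}
    (hβ : (Module.finrank ℝ K : ℝ) = β) (hc : 1 < c) (hp : 0 < p)
    (h : IsGammaEnsemble β p c μ) :
    IsStandardMeixner (standardize (2 * p * c * √(1 + β)) √(4 * p * c ^ 2 * (1 + β)) μ)
      (1 / (4 * p)) (1 / √p) := by
  have hprob := h.isProbabilityMeasure
  have hβ0 : 0 ≤ β := by rw [← hβ]; positivity
  have hmean := h.mean_eq hc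
  have hsecond := h.secondMoment_eq hβ hc
  have hsqrt : √(1 + β) ^ 2 = 1 + β := Real.sq_sqrt (by positivity)
  have hσ2 : √(4 * p * c ^ 2 * (1 + β)) ^ 2 = 4 * p * c ^ 2 * (1 + β) :=
    Real.sq_sqrt (by positivity)
  have hm : 2 * p * c * √(1 + β) = √(4 * p * c ^ 2 * (1 + β)) * √p := by
    rw [← Real.sqrt_mul (by positivity)]
    symm
    rw [Real.sqrt_eq_iff_mul_self_eq (by positivity) (by positivity)]
    linear_combination -(4 * p ^ 2 * c ^ 2) * hsqrt
  have hσ : 0 < √(4 * p * c ^ 2 * (1 + β)) := Real.sqrt_pos.2 (by positivity)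
  set m := 2 * p * c * √(1 + β) with hmdef
  set σ := √(4 * p * c ^ 2 * (1 + β)) with hσdef
  let g : Herm 2 K → Herm 2 K := fun X => σ⁻¹ • (X - m • (1 : Herm 2 K))
  have hgc : Continuous g := by
    simp only [g]
    fun_prop
  have hg : Measurable g := hgc.measurable
  have hgval : ∀ X : Herm 2 K, (g X : Matrix (Fin 2) (Fin 2) K) =
      σ⁻¹ • ((X : Matrix (Fin 2) (Fin 2) K) - m • 1) := fun X => rfl
  have hgsub : ∀ X Y : Herm 2 K, ((g X - g Y : Herm 2 K) : Matrix (Fin 2) (Fin 2) K) =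
      σ⁻¹ • ((X - Y : Herm 2 K) : Matrix (Fin 2) (Fin 2) K) := fun X Y => by
    rw [AddSubgroup.coe_sub, hgval, hgval, AddSubgroup.coe_sub]
    module
  have hgadd' : ∀ X Y : Herm 2 K, g X + g Y = σ⁻¹ • (X + Y - (2 * m) • (1 : Herm 2 K)) :=
    fun X Y => by
      simp only [g]
      module
  have hgadd : ∀ X Y : Herm 2 K, ((g X + g Y : Herm 2 K) : Matrix (Fin 2) (Fin 2) K) =
      σ⁻¹ • (((X + Y : Herm 2 K) : Matrix (Fin 2) (Fin 2) K) - (2 * m) • 1) := fun X Y => by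
    rw [hgadd']
    rfl
  have hentry : ∀ {F : Matrix (Fin 2) (Fin 2) K → Matrix (Fin 2) (Fin 2) K}, Continuous F →
      ∀ i j, StronglyMeasurable fun X : Herm 2 K => F (X : Matrix (Fin 2) (Fin 2) K) i j :=
    fun hF i j => ((hF.comp continuous_subtype_val).matrix_elem i j).stronglyMeasurable
  have hi1 := h.integrable_entry hc
  have hi2 := h.integrable_sq_entry hβ hc
  have hstd : standardize m σ μ = μ.map g := rfl
  have hprob' : IsProbabilityMeasure (μ.map g) := Measure.isProbabilityMeasure_map hg.aemeasurable
  have hprod : (μ.map g).prod (μ.map g) = (μ.prod μ).map (Prod.map g g) :=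
    Measure.map_prod_map _ _ hg hg
  have hgg : Measurable (Prod.map g g) := hg.prodMap hg
  rw [hstd]
  refine ⟨fun i j => ?_, ?_, ?_, ?_⟩
  · rw [memLp_map_measure_iff (hentry (F := fun M => M) continuous_id i j).aestronglyMeasurable hg.aemeasurable]
    exact ((h.hasSecondMoments hc i j).sub (memLp_const _)).const_smul σ⁻¹
  · ext i j
    have hm' := congrFun (congrFun hmean i) j
    simp only [mean, Matrix.of_apply] at hm' ⊢
    rw [integral_map hg.aemeasurable (hentry (F := fun M => M) continuous_id i j).aestronglyMeasurable]
    simp only [hgval, Matrix.smul_apply, Matrix.sub_apply] at hm' ⊢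
    rw [integral_smul, integral_sub (hi1 i j) (integrable_const _), hm']
    simp
  · ext i j
    have hm' := congrFun (congrFun hmean i) j
    have hs' := congrFun (congrFun hsecond i) j
    simp only [mean, secondMoment, Matrix.of_apply, Matrix.smul_apply] at hm' hs' ⊢
    rw [integral_map hg.aemeasurable
      (hentry (F := fun M => M ^ 2) (by fun_prop) i j).aestronglyMeasurable]
    simp only [hgval, sq_smul_sub_smul_one, Matrix.smul_apply, Matrix.sub_apply, Matrix.add_apply]
    have hi1' : Integrable (fun X : Herm 2 K => (2 * m) • (X : Matrix (Fin 2) (Fin 2) K) i j) μ :=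
      (hi1 i j).smul _
    have hi12 : Integrable (fun X : Herm 2 K => ((X : Matrix (Fin 2) (Fin 2) K) ^ 2) i j -
        (2 * m) • (X : Matrix (Fin 2) (Fin 2) K) i j) μ := (hi2 i j).sub hi1'
    rw [integral_smul, integral_add hi12 (integrable_const _), integral_sub (hi2 i j) hi1',
      integral_smul, hs', hm', integral_const, probReal_univ, one_smul]
    -- What remains is `E X² - 2m·m + m² = σ²` on multiples of the identity.
    match_scalars
    rw [inv_pow, hσ2, hmdef]
    field_simp
    linear_combination 4 * hsqrt
  · have hcomp : ∀ ω : Herm 2 K × Herm 2 K,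
        (Prod.map g g ω).1 = g ω.1 ∧ (Prod.map g g ω).2 = g ω.2 := fun ω => ⟨rfl, rfl⟩
    have hS : Measurable fun ω : Herm 2 K × Herm 2 K => ω.1 + ω.2 :=
      measurable_fst.add measurable_snd
    have hdiff : ∀ i j, StronglyMeasurable fun ω : Herm 2 K × Herm 2 K =>
        (((ω.1 - ω.2 : Herm 2 K) : Matrix (Fin 2) (Fin 2) K) ^ 2) i j := fun i j =>
      (hentry (F := fun M => M ^ 2) (by fun_prop) i j).comp_measurable
        (measurable_fst.sub measurable_snd)
    let F : Matrix (Fin 2) (Fin 2) K → Matrix (Fin 2) (Fin 2) K := fun S =>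
      (2 / (1 + 2 * (1 / (4 * p)))) • (1 + (1 / √p) • S + (1 / (4 * p)) • S ^ 2)
    have hF : Continuous F := by fun_prop
    have hsum : ∀ i j, StronglyMeasurable fun ω : Herm 2 K × Herm 2 K =>
        F ((ω.1 + ω.2 : Herm 2 K) : Matrix (Fin 2) (Fin 2) K) i j := fun i j =>
      (hentry hF i j).comp_measurable hS
    have hsq1 : ∀ (ω : Herm 2 K × Herm 2 K) i j,
        (((g ω.1 - g ω.2 : Herm 2 K) : Matrix (Fin 2) (Fin 2) K) ^ 2) i j =
        (σ⁻¹) ^ 2 • (((ω.1 - ω.2 : Herm 2 K) : Matrix (Fin 2) (Fin 2) K) ^ 2) i j :=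
      fun ω i j => by rw [hgsub, smul_pow, Matrix.smul_apply]
    have hsq2 : ∀ (ω : Herm 2 K × Herm 2 K) i j,
        F ((g ω.1 + g ω.2 : Herm 2 K) : Matrix (Fin 2) (Fin 2) K) i j = (σ⁻¹) ^ 2 •
        ((1 / (1 + 2 * p)) • (((ω.1 + ω.2 : Herm 2 K) : Matrix (Fin 2) (Fin 2) K) ^ 2) i j) :=
      fun ω i j => by
        rw [hgadd]
        simp only [F]
        rw [standardized_meixner_eq_smul hp hσ.ne' hm]
        rfl
    refine condSqDiffEq_of_setIntegral (F := F) hF (fun i j => ?_) (fun i j => ?_)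
      fun i j B hB => ?_
    · rw [hprod, integrable_map_measure (hdiff i j).aestronglyMeasurable hgg.aemeasurable]
      simp only [Function.comp_def, hcomp, hsq1]
      exact (h.integrable_sq_entry_pair hβ hc i j).1.smul ((σ⁻¹) ^ 2)
    · rw [hprod, integrable_map_measure (hsum i j).aestronglyMeasurable hgg.aemeasurable]
      simp only [Function.comp_def, hcomp, hsq2]
      exact ((h.integrable_sq_entry_pair hβ hc i j).2.smul (1 / (1 + 2 * p))).smul ((σ⁻¹) ^ 2)
    · rw [hprod, setIntegral_map (hS hB) (hdiff i j).aestronglyMeasurable hgg.aemeasurable,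
        setIntegral_map (hS hB) (hsum i j).aestronglyMeasurable hgg.aemeasurable]
      simp only [hcomp, hsq1, hsq2]
      -- The standardized sum is an affine image of `X + Y`, so an event about it is an event about
      -- `X + Y`, and the unstandardized identity applies.
      have hpre : Prod.map g g ⁻¹' ((fun ω : Herm 2 K × Herm 2 K => ω.1 + ω.2) ⁻¹' B) =
          (fun ω : Herm 2 K × Herm 2 K => ω.1 + ω.2) ⁻¹'
            ((fun X : Herm 2 K => σ⁻¹ • (X - (2 * m) • (1 : Herm 2 K))) ⁻¹' B) := by
        ext ω
        simp only [Set.mem_preimage, hcomp, hgadd']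
      have hB' : MeasurableSet
          ((fun X : Herm 2 K => σ⁻¹ • (X - (2 * m) • (1 : Herm 2 K))) ⁻¹' B) :=
        (Continuous.measurable (by fun_prop)) hB
      rw [hpre, integral_smul, integral_smul, h.setIntegral_sq hβ hc hp i j hB']

end CondExp

end MatrixEnsemble

end

theorem proposition3p15 (p c : ℝ) (hc : 1 < c) :
    -- real symmetric matrices, `β = 1`
    (1 / 2 < p → ∀ μ : Measure (MatrixEnsemble.Herm 2 ℝ),
      MatrixEnsemble.IsGammaEnsemble 1 p c μ →
        MatrixEnsemble.IsMeixnerEnsemble μ (1 / (1 + 2 * p)) 0 0 ∧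
        MatrixEnsemble.mean μ = (2 * p * c * √(1 + 1)) • (1 : Matrix (Fin 2) (Fin 2) ℝ) ∧
        MatrixEnsemble.variance μ =
          (4 * p * c ^ 2 * (1 + 1)) • (1 : Matrix (Fin 2) (Fin 2) ℝ) ∧
        MatrixEnsemble.IsStandardMeixner
          (MatrixEnsemble.standardize (2 * p * c * √(1 + 1)) √(4 * p * c ^ 2 * (1 + 1)) μ)
          (1 / (4 * p)) (1 / √p)) ∧
    -- complex Hermitian matrices, `β = 2`
    (2 / 2 < p → ∀ μ : Measure (MatrixEnsemble.Herm 2 ℂ),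
      MatrixEnsemble.IsGammaEnsemble 2 p c μ →
        MatrixEnsemble.IsMeixnerEnsemble μ (1 / (1 + 2 * p)) 0 0 ∧
        MatrixEnsemble.mean μ = (2 * p * c * √(1 + 2)) • (1 : Matrix (Fin 2) (Fin 2) ℂ) ∧
        MatrixEnsemble.variance μ =
          (4 * p * c ^ 2 * (1 + 2)) • (1 : Matrix (Fin 2) (Fin 2) ℂ) ∧
        MatrixEnsemble.IsStandardMeixner
          (MatrixEnsemble.standardize (2 * p * c * √(1 + 2)) √(4 * p * c ^ 2 * (1 + 2)) μ)
          (1 / (4 * p)) (1 / √p)) ∧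
    -- quaternion-Hermitian matrices, `β = 4`
    (4 / 2 < p → ∀ μ : Measure (MatrixEnsemble.Herm 2 ℍ[ℝ]),
      MatrixEnsemble.IsGammaEnsemble 4 p c μ →
        MatrixEnsemble.IsMeixnerEnsemble μ (1 / (1 + 2 * p)) 0 0 ∧
        MatrixEnsemble.mean μ = (2 * p * c * √(1 + 4)) • (1 : Matrix (Fin 2) (Fin 2) ℍ[ℝ]) ∧
        MatrixEnsemble.variance μ =
          (4 * p * c ^ 2 * (1 + 4)) • (1 : Matrix (Fin 2) (Fin 2) ℍ[ℝ]) ∧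
        MatrixEnsemble.IsStandardMeixner
          (MatrixEnsemble.standardize (2 * p * c * √(1 + 4)) √(4 * p * c ^ 2 * (1 + 4)) μ)
          (1 / (4 * p)) (1 / √p)) := by
  have h1 : (Module.finrank ℝ ℝ : ℝ) = 1 := by simp
  have h2 : (Module.finrank ℝ ℂ : ℝ) = 2 := by simp [Complex.finrank_real_complex]
  have h4 : (Module.finrank ℝ ℍ[ℝ] : ℝ) = 4 := by simp [Quaternion.finrank_eq_four]
  refine ⟨fun hp μ h => ?_, fun hp μ h => ?_, fun hp μ h => ?_⟩
  · have hp0 : 0 < p := by linarith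
    exact ⟨MatrixEnsemble.isMeixnerEnsemble_of_isGammaEnsemble h1 hc hp0 h, h.mean_eq hc,
      h.variance_eq h1 hc, MatrixEnsemble.isStandardMeixner_standardize h1 hc hp0 h⟩
  · have hp0 : 0 < p := by linarith
    exact ⟨MatrixEnsemble.isMeixnerEnsemble_of_isGammaEnsemble h2 hc hp0 h, h.mean_eq hc,
      h.variance_eq h2 hc, MatrixEnsemble.isStandardMeixner_standardize h2 hc hp0 h⟩
  · have hp0 : 0 < p := by linarith
    exact ⟨MatrixEnsemble.isMeixnerEnsemble_of_isGammaEnsemble h4 hc hp0 h, h.mean_eq hc,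
      h.variance_eq h4 hc, MatrixEnsemble.isStandardMeixner_standardize h4 hc hp0 h⟩
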